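/- Let $d,k\ge 0$ be integers, let $\Gamma$ be an (additively written) group isomorphic to $\mathbb{Z}^k$, and let $L:\Gamma\to\mathbb{R}^d$ be a nonsingular homomorphism, i.e. $L(\Gamma)$ spans a $k$-dimensional linear subspace of $\mathbb{R}^d$ (so $k\le d$). Let $(G,\psi)$ be a finite $\Gamma$-labeled graph: a finite directed multigraph $G=(V,E)$ without loops and a map $\psi:E\to\Gamma$, such that no two distinct edges are parallel with the same direction and the same label, or with opposite directions and opposite labels. For $p:V\to\mathbb{R}^d$ put $$f_{G,L}(p)=\bigl(\|p(u)-(p(v)+L(\psi(e)))\|^2\bigr)_{e\in E,\ e\text{ directed from }u\text{ to }v},\qquad f_{V,L}(p)=\bigl(\|p(u)-(p(v)+L(\gamma))\|^2\bigr)_{(u,v,\gamma)\in V\times V\times\Gamma}.$$ The triple $(G,\psi,p)$ is called $L$-periodically globally rigid if for every $q:V\to\mathbb{R}^d$, $f_{G,L}(p)=f_{G,L}(q)$ implies $f_{V,L}(p)=f_{V,L}(q)$; it is called $L$-periodically rigid if this implication holds for every $q$ in some open neighbourhood of $p$ in $(\mathbb{R}^d)^V$; and it is called redundantly $L$-periodically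 rigid if $(G-e,\psi|_{E\setminus\{e\}},p)$ is $L$-periodically rigid for every $e\in E$. It is called generic if the $d|V|$ coordinates of the points $p(v)$, $v\in V$, are algebraically independent over the field generated over $\mathbb{Q}$ by the coordinates of the vectors $L(\gamma)$, $\gamma\in\Gamma$ (this field is $\mathbb{Q}$ if $L$ is rational-valued). Suppose that $(G,\psi,p)$ is generic, and that $|V|\ge d+1$ if $k\ge 1$ and $|V|\ge d+2$ if $k=0$. If $(G,\psi,p)$ is $L$-periodically globally rigid, then it is redundantly $L$-periodically rigid. -/

import Mathlib

/-- A directed multigraph on the vertex set `V` with edge set `E`, together with a labelling of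
its edges by elements of `Γ` (written additively). -/
structure LabeledGraph (V E Γ : Type*) where
  /-- initial vertex of an edge -/
  src : E → V
  /-- terminal vertex of an edge -/
  tgt : E → V
  /-- label of an edge, with respect to its direction -/
  label : E → Γ

namespace LabeledGraph

/-- No edge joins a vertex to itself. -/
def IsLoopless {V E Γ : Type*} (G : LabeledGraph V E Γ) : Prop :=
  ∀ e : E, G.src e ≠ G.tgt e

/-- Two edges are identical if they are parallel with the same direction and the same label, or
with opposite directions and opposite labels. -/
def Identical {V E Γ : Type*} [AddCommGroup Γ] (G : LabeledGraph V E Γ) (e e' : E) : Prop :=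
  (G.src e = G.src e' ∧ G.tgt e = G.tgt e' ∧ G.label e = G.label e') ∨
  (G.src e = G.tgt e' ∧ G.tgt e = G.src e' ∧ G.label e = -G.label e')

/-- No two distinct edges are identical. -/
def IsSemiSimple {V E Γ : Type*} [AddCommGroup Γ] (G : LabeledGraph V E Γ) : Prop :=
  ∀ e e' : E, G.Identical e e' → e = e'

/-- The graph `G - e`. -/
def deleteEdge {V E Γ : Type*} (G : LabeledGraph V E Γ) (e : E) :
    LabeledGraph V {e' : E // e' ≠ e} Γ where
  src e' := G.src e'.1
  tgt e' := G.tgt e'.1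
  label e' := G.label e'.1

/-- The complete `Γ`-labeled graph `K(V, Γ)`: one edge from `u` to `v` with label `γ`, for all
`u`, `v` and `γ`. -/
def complete (V Γ : Type*) : LabeledGraph V (V × V × Γ) Γ where
  src e := e.1
  tgt e := e.2.1
  label e := e.2.2

/-- The squared length function `f_{G,L}`. -/
noncomputable def lengthSq {V E Γ : Type*} [AddCommGroup Γ] {d : ℕ} (G : LabeledGraph V E Γ)
    (L : Γ →+ EuclideanSpace ℝ (Fin d)) (p : V → EuclideanSpace ℝ (Fin d)) : E → ℝ :=
  fun e => ‖p (G.src e) - (p (G.tgt e) + L (G.label e))‖ ^ 2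

/-- `L`-periodic global rigidity of the `Γ`-labeled framework `(G, p)`: for every `q`,
`f_{G,L}(p) = f_{G,L}(q)` implies `f_{V,L}(p) = f_{V,L}(q)`. -/
def IsPeriodicallyGloballyRigid {V E Γ : Type*} [AddCommGroup Γ] {d : ℕ}
    (G : LabeledGraph V E Γ) (L : Γ →+ EuclideanSpace ℝ (Fin d))
    (p : V → EuclideanSpace ℝ (Fin d)) : Prop :=
  ∀ q : V → EuclideanSpace ℝ (Fin d), G.lengthSq L p = G.lengthSq L q →
    (complete V Γ).lengthSq L p = (complete V Γ).lengthSq L q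

/-- `L`-periodic (local) rigidity of the `Γ`-labeled framework `(G, p)`: the implication
that defines global rigidity holds for every `q` in some open neighbourhood of `p`. -/
def IsPeriodicallyRigid {V E Γ : Type*} [AddCommGroup Γ] {d : ℕ}
    (G : LabeledGraph V E Γ) (L : Γ →+ EuclideanSpace ℝ (Fin d))
    (p : V → EuclideanSpace ℝ (Fin d)) : Prop :=
  ∃ N : Set (V → EuclideanSpace ℝ (Fin d)), IsOpen N ∧ p ∈ N ∧
    ∀ q ∈ N, G.lengthSq L p = G.lengthSq L q →
      (complete V Γ).lengthSq L p = (complete V Γ).lengthSq L q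

/-- Redundant `L`-periodic rigidity: `(G - e, p)` is `L`-periodically rigid for every edge `e`. -/
def IsRedundantlyPeriodicallyRigid {V E Γ : Type*} [AddCommGroup Γ] {d : ℕ}
    (G : LabeledGraph V E Γ) (L : Γ →+ EuclideanSpace ℝ (Fin d))
    (p : V → EuclideanSpace ℝ (Fin d)) : Prop :=
  ∀ e : E, (G.deleteEdge e).IsPeriodicallyRigid L p

end LabeledGraph

/-- For `Γ ≅ ℤ^k`, the homomorphism `L` is nonsingular if `L(Γ)` has rank `k`, i.e. spans a
`k`-dimensional linear subspace. -/
def IsNonsingularLattice {Γ : Type*} [AddCommGroup Γ] {d : ℕ} (k : ℕ)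
    (L : Γ →+ EuclideanSpace ℝ (Fin d)) : Prop :=
  Module.finrank ℝ (Submodule.span ℝ (Set.range L)) = k

/-- The subfield `ℚ(H)` of `ℝ` generated by the coordinates of the vectors `L(γ)`. It is `ℚ` if
`L` is rational-valued. -/
noncomputable def coordField {Γ : Type*} [AddCommGroup Γ] {d : ℕ}
    (L : Γ →+ EuclideanSpace ℝ (Fin d)) : IntermediateField ℚ ℝ :=
  IntermediateField.adjoin ℚ {x : ℝ | ∃ (γ : Γ) (i : Fin d), L γ i = x}

/-- `p` is generic with respect to `L` if its coordinates are algebraically independent over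
`ℚ(H)`, hence over `ℚ` if `L` is rational-valued. -/
def IsGenericRealization {V Γ : Type*} [AddCommGroup Γ] {d : ℕ}
    (L : Γ →+ EuclideanSpace ℝ (Fin d)) (p : V → EuclideanSpace ℝ (Fin d)) : Prop :=
  AlgebraicIndependent (coordField L) (fun vi : V × Fin d => p vi.1 vi.2)

/-!
Hendrickson's argument. Suppose that `G - e` is not rigid at the generic realization `p`. By
genericity every point of the fibre of the squared length map of `G - e` through `p` is regular, and
the fibre modulo congruence is a Hausdorff one-dimensional manifold `Y`. The squared length `h` of
`e` is a continuous function on `Y`; it is not locally extremal at the class `y₀` of `p`, and its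
sublevel set `{h ≤ h y₀}` is compact because `G` is connected. If `h` took the value `h y₀` only at
`y₀` on the component of `y₀`, then `y₀` would be a cut point of that component, and so would be
every other point, since being a cut point is a locally constant property on a one-dimensional
manifold. But the compact connected set `{h ≤ h y₀}` has a non-cut point other than `y₀`. Hence `h`
takes the value `h y₀` again, at a realization with the same edge lengths in `G` as `p` that is not
congruent to `p`.
-/

open Set Filter Topology
open scoped RealInnerProductSpace

theorem exists_derivation_of_isTranscendenceBasis {K L ι : Type*} [Field K] [Field L] [CharZero L]
    [Algebra K L] {v : ι → L} (hv : IsTranscendenceBasis K v) (w : ι → L) :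
    ∃ D : Derivation K L L, ∀ i, D (v i) = w i := by
  let S := MvPolynomial ι K
  let : Algebra S L := (MvPolynomial.aeval v : S →ₐ[K] L).toAlgebra
  have : IsScalarTower K S L :=
    IsScalarTower.of_algebraMap_eq fun x => ((MvPolynomial.aeval v : S →ₐ[K] L).commutes x).symm
  have : FaithfulSMul S L := (faithfulSMul_iff_algebraMap_injective S L).2 hv.1
  have : Algebra.IsAlgebraic S L :=
    have := hv.isAlgebraic
    .of_ringHom_of_comp_eq hv.1.aevalEquiv (RingHom.id L) hv.1.aevalEquiv.surjective
      Function.injective_id (by ext <;> simp [S, RingHom.algebraMap_toAlgebra])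
  let F := FractionRing S
  let : Algebra F L := FractionRing.liftAlgebra S L
  have : Algebra.IsAlgebraic F L := (IsFractionRing.comap_isAlgebraic_iff (A := S)).1 ‹_›
  have : CharZero F := (algebraMap F L).charZero
  have : Algebra.FormallyEtale S F := .of_isLocalization (nonZeroDivisors S)
  have : Algebra.FormallyEtale F L := Algebra.FormallyEtale.of_isSeparable F L
  have : Algebra.FormallyEtale S L := .comp S F L
  let D₀ : Derivation K S L := MvPolynomial.mkDerivation K w
  let Φ : Ω[L⁄K] →ₗ[L] L := (LinearMap.liftBaseChange L D₀.liftKaehlerDifferential) ∘ₗ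
    (KaehlerDifferential.tensorKaehlerEquivOfFormallyEtale K S L).symm.toLinearMap
  have hΦ (s : S) : Φ (KaehlerDifferential.D K L (algebraMap S L s)) = D₀ s := by
    simp [Φ, KaehlerDifferential.tensorKaehlerEquivOfFormallyEtale_symm_D_algebraMap]
  refine ⟨Φ.compDer (KaehlerDifferential.D K L), fun i => ?_⟩
  calc Φ (KaehlerDifferential.D K L (v i))
      = Φ (KaehlerDifferential.D K L (algebraMap S L (MvPolynomial.X i))) := by
        rw [show algebraMap S L (MvPolynomial.X i) = v i from MvPolynomial.aeval_X v i]
    _ = w i := by rw [hΦ, MvPolynomial.mkDerivation_X]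

theorem exists_derivation_of_algebraicIndependent {K L ι : Type*} [Field K] [Field L] [CharZero L]
    [Algebra K L] {v : ι → L} (hv : AlgebraicIndependent K v) (w : ι → L) :
    ∃ D : Derivation K L L, ∀ i, D (v i) = w i := by
  obtain ⟨t, hvt, ht⟩ := exists_isTranscendenceBasis_superset hv.coe_range
  obtain ⟨D, hD⟩ := exists_derivation_of_isTranscendenceBasis ht
    (fun x : t => Function.extend v w 0 x.1)
  exact ⟨D, fun i => by rw [hD ⟨v i, hvt ⟨i, rfl⟩⟩, hv.injective.extend_apply]⟩

theorem exists_linearIndependent_row_submatrix {K m n : Type*} [Field K] [Finite m] [Fintype n]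
    (A : Matrix m n K) {ρ : ℕ} (hρ : A.rank = ρ) :
    ∃ r : Fin ρ → m, LinearIndependent K (A.submatrix r id).row := by
  rw [Matrix.rank_eq_finrank_span_row] at hρ
  subst hρ
  obtain ⟨f, hf, -, hli⟩ := Submodule.exists_fun_fin_finrank_span_eq K (Set.range A.row)
  choose r hr using hf
  exact ⟨r, (funext hr : (A.submatrix r id).row = f) ▸ hli⟩

theorem exists_det_submatrix_ne_zero {K m n : Type*} [Field K] [Finite m] [Fintype n]
    (A : Matrix m n K) :
    ∃ (r : Fin A.rank → m) (c : Fin A.rank → n), (A.submatrix r c).det ≠ 0 := by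
  obtain ⟨r, hr⟩ := exists_linearIndependent_row_submatrix A rfl
  have hrank : (A.submatrix r id).transpose.rank = A.rank := by
    rw [Matrix.rank_transpose, hr.rank_matrix, Fintype.card_fin]
  obtain ⟨c, hc⟩ := exists_linearIndependent_row_submatrix _ hrank
  exact ⟨r, c, (Matrix.isUnit_iff_isUnit_det _).1
    (Matrix.linearIndependent_cols_iff_isUnit.1 hc) |>.ne_zero⟩

theorem rank_map_aeval_le_of_algebraicIndependent {K L ι m n : Type*} [Field K] [Field L]
    [Algebra K L] [Finite m] [Fintype n] {v : ι → L} (hv : AlgebraicIndependent K v)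
    (A : Matrix m n (MvPolynomial ι K)) (x : ι → L) :
    (A.map (MvPolynomial.aeval x)).rank ≤ (A.map (MvPolynomial.aeval v)).rank := by
  obtain ⟨r, c, hrc⟩ := exists_det_submatrix_ne_zero (A.map (MvPolynomial.aeval x))
  have hdet (y : ι → L) : ((A.map (MvPolynomial.aeval y)).submatrix r c).det =
      MvPolynomial.aeval y (A.submatrix r c).det := by
    rw [AlgHom.map_det]; rfl
  have hminor : ((A.map (MvPolynomial.aeval v)).submatrix r c).det ≠ 0 := by
    rw [hdet] at hrc ⊢
    exact (map_ne_zero_iff _ hv).2 (ne_of_apply_ne _ (hrc.trans_eq (map_zero _).symm))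
  calc (A.map (MvPolynomial.aeval x)).rank
      = ((A.map (MvPolynomial.aeval v)).submatrix r c).rank := by
        rw [Matrix.rank_of_isUnit _ ((Matrix.isUnit_iff_isUnit_det _).2 hminor.isUnit),
          Fintype.card_fin]
    _ ≤ (A.map (MvPolynomial.aeval v)).rank := Matrix.rank_submatrix_le _ _ _

namespace LabeledGraph

section Rigidity

variable {V E Γ : Type*} [AddCommGroup Γ] {d : ℕ} (G : LabeledGraph V E Γ)
  (L : Γ →+ EuclideanSpace ℝ (Fin d)) {p q : V → EuclideanSpace ℝ (Fin d)}

/-- The vector `p u - p v` along an edge from `u` to `v`, as a function of `p`. -/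
noncomputable def edgeDiff (e : E) :
    (V → EuclideanSpace ℝ (Fin d)) →L[ℝ] EuclideanSpace ℝ (Fin d) :=
  .proj (R := ℝ) (φ := fun _ => EuclideanSpace ℝ (Fin d)) (G.src e) - .proj (G.tgt e)

/-- The rigidity map: the derivative of the squared length function `f_{G,L}` at `p`. -/
noncomputable def rigidityMap (p : V → EuclideanSpace ℝ (Fin d)) :
    (V → EuclideanSpace ℝ (Fin d)) →L[ℝ] (E → ℝ) :=
  ContinuousLinearMap.pi fun e =>
    (2 : ℕ) • (innerSL ℝ (p (G.src e) - (p (G.tgt e) + L (G.label e)))).comp (G.edgeDiff e)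

theorem rigidityMap_apply (p w : V → EuclideanSpace ℝ (Fin d)) (e : E) :
    G.rigidityMap L p w e =
      2 * ⟪p (G.src e) - (p (G.tgt e) + L (G.label e)), w (G.src e) - w (G.tgt e)⟫ := by
  simp [rigidityMap, edgeDiff, inner_sub_left, inner_sub_right, inner_add_left]

theorem mem_ker_rigidityMap {p w : V → EuclideanSpace ℝ (Fin d)} :
    w ∈ (G.rigidityMap L p).ker ↔
      ∀ e, ⟪p (G.src e) - (p (G.tgt e) + L (G.label e)), w (G.src e) - w (G.tgt e)⟫ = 0 := by
  simp [LinearMap.mem_ker, funext_iff, rigidityMap_apply]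

theorem contDiff_lengthSq [Fintype V] [Fintype E] : ContDiff ℝ 1 (G.lengthSq L) := by
  refine contDiff_pi.2 fun e => ContDiff.norm_sq ℝ ?_
  fun_prop

theorem hasFDerivAt_lengthSq [Finite V] (p : V → EuclideanSpace ℝ (Fin d)) :
    HasFDerivAt (G.lengthSq L) (G.rigidityMap L p) p := by
  have := Fintype.ofFinite V
  refine hasFDerivAt_pi.2 fun e => HasFDerivAt.norm_sq ?_
  convert! (G.edgeDiff (d := d) e).hasFDerivAt.sub_const (L (G.label e)) using 2
  simp [edgeDiff, sub_sub]

theorem fderiv_lengthSq [Finite V] (p : V → EuclideanSpace ℝ (Fin d)) :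
    fderiv ℝ (G.lengthSq L) p = G.rigidityMap L p :=
  (G.hasFDerivAt_lengthSq L p).fderiv

theorem fderiv_lengthSq_apply [Finite V] (p w : V → EuclideanSpace ℝ (Fin d)) (e : E) :
    fderiv ℝ (fun q => G.lengthSq L q e) p w = G.rigidityMap L p w e := by
  have := Fintype.ofFinite V
  rw [(hasFDerivAt_pi'.1 (G.hasFDerivAt_lengthSq L p) e).fderiv]
  rfl

/-- The Jacobian matrix of `f_{G,L}`, with polynomial entries. -/
noncomputable def rigidityMatrix :
    Matrix E (V × Fin d) (MvPolynomial (V × Fin d) (coordField L)) :=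
  open Classical in Matrix.of fun e vi =>
    2 * (MvPolynomial.X (G.src e, vi.2) - (MvPolynomial.X (G.tgt e, vi.2) +
      MvPolynomial.C ⟨L (G.label e) vi.2, IntermediateField.subset_adjoin _ _ ⟨_, _, rfl⟩⟩)) *
      ((if vi.1 = G.src e then 1 else 0) - (if vi.1 = G.tgt e then 1 else 0))

theorem aeval_rigidityMatrix_mulVec [Fintype V] (p w : V → EuclideanSpace ℝ (Fin d)) :
    ((G.rigidityMatrix L).map (MvPolynomial.aeval fun vi : V × Fin d => p vi.1 vi.2)).mulVec
      (fun vi => w vi.1 vi.2) = G.rigidityMap L p w := by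
  classical
  ext e
  have hC (i : Fin d) : algebraMap (coordField L) ℝ ⟨L (G.label e) i,
    IntermediateField.subset_adjoin _ _ ⟨_, _, rfl⟩⟩ = L (G.label e) i := rfl
  rw [rigidityMap_apply, Matrix.mulVec, dotProduct, Fintype.sum_prod_type_right,
    PiLp.inner_apply, Finset.mul_sum]
  refine Finset.sum_congr rfl fun i _ => ?_
  simp only [rigidityMatrix, Matrix.map_apply, Matrix.of_apply, map_mul, map_sub, map_add,
    MvPolynomial.aeval_X, MvPolynomial.aeval_C, hC, map_ofNat, apply_ite (MvPolynomial.aeval _),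
    map_one, map_zero, mul_assoc, ← Finset.mul_sum, sub_mul, ite_mul, one_mul, zero_mul,
    Finset.sum_sub_distrib, Finset.sum_ite_eq', Finset.mem_univ, if_true]
  simp only [PiLp.sub_apply, PiLp.add_apply, RCLike.inner_apply, conj_trivial]
  ring

theorem finrank_range_rigidityMap [Fintype V] (p : V → EuclideanSpace ℝ (Fin d)) :
    Module.finrank ℝ (G.rigidityMap L p).range = ((G.rigidityMatrix L).map
      (MvPolynomial.aeval fun vi : V × Fin d => p vi.1 vi.2)).rank := by
  have hrange : (G.rigidityMap L p).range = ((G.rigidityMatrix L).map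
      (MvPolynomial.aeval fun vi : V × Fin d => p vi.1 vi.2)).mulVecLin.range := by
    refine le_antisymm ?_ ?_
    · rintro _ ⟨w, rfl⟩
      exact ⟨_, G.aeval_rigidityMatrix_mulVec L p w⟩
    · rintro _ ⟨w, rfl⟩
      exact ⟨fun v => WithLp.toLp 2 fun i => w (v, i),
        (G.aeval_rigidityMatrix_mulVec L p _).symm⟩
  rw [Matrix.rank, hrange]

theorem finrank_ker_rigidityMap_le_of_generic [Finite V] [Finite E]
    (hp : IsGenericRealization L p) (q : V → EuclideanSpace ℝ (Fin d)) :
    Module.finrank ℝ (G.rigidityMap L p).ker ≤ Module.finrank ℝ (G.rigidityMap L q).ker := by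
  have := Fintype.ofFinite V
  have hrank := rank_map_aeval_le_of_algebraicIndependent hp (G.rigidityMatrix L)
    (fun vi : V × Fin d => q vi.1 vi.2)
  have hp' := (G.rigidityMap L p).toLinearMap.finrank_range_add_finrank_ker
  have hq' := (G.rigidityMap L q).toLinearMap.finrank_range_add_finrank_ker
  rw [← finrank_range_rigidityMap, ← finrank_range_rigidityMap] at hrank
  omega

theorem rigidityMap_derivation (D : Derivation (coordField L) ℝ ℝ)
    (p : V → EuclideanSpace ℝ (Fin d)) :
    G.rigidityMap L p (fun v => WithLp.toLp 2 fun i => D (p v i)) =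
      fun e => D (G.lengthSq L p e) := by
  ext e
  have hL (i : Fin d) : D (L (G.label e) i) = 0 :=
    D.map_algebraMap (⟨L (G.label e) i, IntermediateField.subset_adjoin _ _ ⟨_, _, rfl⟩⟩ :
      coordField L)
  simp only [rigidityMap_apply, lengthSq, EuclideanSpace.real_norm_sq_eq, map_sum,
    PiLp.inner_apply, Finset.mul_sum]
  refine Finset.sum_congr rfl fun i _ => ?_
  simp [hL, Derivation.leibniz_pow]
  ring

theorem range_rigidityMap_le_of_generic (hp : IsGenericRealization L p)
    (hpq : G.lengthSq L q = G.lengthSq L p) :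
    (G.rigidityMap L p).range ≤ (G.rigidityMap L q).range := by
  rintro _ ⟨w, rfl⟩
  obtain ⟨D, hD⟩ := exists_derivation_of_algebraicIndependent hp (fun vi => w vi.1 vi.2)
  have hw : w = fun v => WithLp.toLp 2 fun i => D (p v i) := by
    ext v i
    exact (hD (v, i)).symm
  refine ⟨fun v => WithLp.toLp 2 fun i => D (q v i), ?_⟩
  calc G.rigidityMap L q _ = fun e => D (G.lengthSq L q e) := G.rigidityMap_derivation L D q
    _ = G.rigidityMap L p w := by rw [hpq, ← G.rigidityMap_derivation L D p, ← hw]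

theorem finrank_ker_rigidityMap_eq_of_generic [Finite V] [Finite E]
    (hp : IsGenericRealization L p) (hpq : G.lengthSq L q = G.lengthSq L p) :
    Module.finrank ℝ (G.rigidityMap L q).ker = Module.finrank ℝ (G.rigidityMap L p).ker := by
  have hrange := Submodule.finrank_mono (range_rigidityMap_le_of_generic G L hp hpq)
  have hle := G.finrank_ker_rigidityMap_le_of_generic L hp q
  have hp' := (G.rigidityMap L p).toLinearMap.finrank_range_add_finrank_ker
  have hq' := (G.rigidityMap L q).toLinearMap.finrank_range_add_finrank_ker
  omega

end Rigidity

end LabeledGraph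

section ConstantRank

variable {X A B : Type*} [NormedAddCommGroup X] [NormedSpace ℝ X]
  [NormedAddCommGroup A] [NormedSpace ℝ A] [NormedAddCommGroup B] [NormedSpace ℝ B]

theorem exists_localInverse_prodMk [CompleteSpace X] [FiniteDimensional ℝ A] {g : X → A}
    {x₀ : X} (hg : ContDiff ℝ 1 g) (hsurj : (fderiv ℝ g x₀).range = ⊤) :
    ∃ (π : X →L[ℝ] (fderiv ℝ g x₀).ker) (ψ : A × (fderiv ℝ g x₀).ker → X),
      ContDiffAt ℝ 1 ψ (g x₀, π x₀) ∧ ψ (g x₀, π x₀) = x₀ ∧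
      (∀ᶠ z in 𝓝 (g x₀, π x₀), (g (ψ z), π (ψ z)) = z) ∧ ∀ᶠ x in 𝓝 x₀, ψ (g x, π x) = x := by
  have := FiniteDimensional.complete ℝ A
  obtain ⟨π, hπ⟩ := (fderiv ℝ g x₀).ker_closedComplemented_of_finiteDimensional_range
  let Φ' : X ≃L[ℝ] A × (fderiv ℝ g x₀).ker :=
    ContinuousLinearMap.equivProdOfSurjectiveOfIsCompl (fderiv ℝ g x₀) π hsurj
      (LinearMap.range_eq_of_proj hπ) (LinearMap.isCompl_of_proj hπ)
  have hΦ : ContDiffAt ℝ 1 (fun x => (g x, π x)) x₀ := (hg.prodMk π.contDiff).contDiffAt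
  have hΦ' : HasFDerivAt (fun x => (g x, π x)) (Φ' : X →L[ℝ] A × (fderiv ℝ g x₀).ker) x₀ :=
    (hg.differentiable one_ne_zero x₀).hasFDerivAt.prodMk π.hasFDerivAt
  have hstrict := hΦ.hasStrictFDerivAt' hΦ' one_ne_zero
  exact ⟨π, hΦ.localInverse hΦ' one_ne_zero, hΦ.to_localInverse hΦ' one_ne_zero,
    hΦ.localInverse_apply_image hΦ' one_ne_zero, hstrict.eventually_right_inverse,
    hstrict.eventually_left_inverse⟩

theorem exists_nhds_eq_of_hasFDerivAt_snd_zero {M : Type*} [PseudoMetricSpace M] {F : M × X → B}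
    {z₀ : M × X}
    (hF : ∀ᶠ z in 𝓝 z₀, HasFDerivAt (fun u => F (z.1, u)) (0 : X →L[ℝ] B) z.2) :
    ∃ N ∈ 𝓝 z₀, ∀ z ∈ N, ∀ z' ∈ N, z.1 = z'.1 → F z = F z' := by
  obtain ⟨δ, hδ, hball⟩ := Metric.eventually_nhds_iff_ball.1 hF
  refine ⟨Metric.ball z₀ δ, Metric.ball_mem_nhds _ hδ, ?_⟩
  rintro ⟨a, u⟩ hu ⟨_, u'⟩ hu' rfl
  simp only [← ball_prod_same z₀.1 z₀.2, mem_prod] at hball hu hu'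
  have hderiv : ∀ v ∈ Metric.ball z₀.2 δ, HasFDerivAt (fun v => F (a, v)) (0 : X →L[ℝ] B) v :=
    fun v hv => hball (a, v) ⟨hu.1, hv⟩
  exact Metric.isOpen_ball.is_const_of_fderiv_eq_zero (𝕜 := ℝ) (convex_ball _ _).isPreconnected
    (fun v hv => (hderiv v hv).differentiableAt.differentiableWithinAt)
    (fun v hv => (hderiv v hv).fderiv) hu.2 hu'.2

/-- In the coordinates in which the submersion `g` is a projection, `κ` has vanishing derivative
along the fibres. -/
theorem exists_nhds_eq_of_ker_le_of_range_eq_top [CompleteSpace X] [FiniteDimensional ℝ A]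
    {g : X → A} {κ : X → B} {x₀ : X} (hg : ContDiff ℝ 1 g) (hκ : Differentiable ℝ κ)
    (hsurj : (fderiv ℝ g x₀).range = ⊤)
    (hker : ∀ᶠ x in 𝓝 x₀, (fderiv ℝ g x).ker ≤ (fderiv ℝ κ x).ker) :
    ∃ N ∈ 𝓝 x₀, ∀ x ∈ N, ∀ x' ∈ N, g x = g x' → κ x = κ x' := by
  obtain ⟨π, ψ, hψ, hψ₀, hright, hleft⟩ := exists_localInverse_prodMk hg hsurj
  have hkerψ : ∀ᶠ z in 𝓝 (g x₀, π x₀), (fderiv ℝ g (ψ z)).ker ≤ (fderiv ℝ κ (ψ z)).ker := by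
    have := hψ.continuousAt.tendsto
    rw [hψ₀] at this
    exact this.eventually hker
  have hfibre : ∀ᶠ z in 𝓝 (g x₀, π x₀), HasFDerivAt (fun u => κ (ψ (z.1, u)))
      (0 : (fderiv ℝ g x₀).ker →L[ℝ] B) z.2 := by
    filter_upwards [hright.eventually_nhds, hkerψ, hψ.eventually (by simp)] with z hz hkz hψz
    have hψu : HasFDerivAt (fun u => ψ (z.1, u)) _ z.2 :=
      (hψz.differentiableAt one_ne_zero).hasFDerivAt.comp z.2 (hasFDerivAt_prodMk_right z.1 z.2)
    have hgψ := (hg.differentiable one_ne_zero (ψ z)).hasFDerivAt.comp z.2 hψu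
    have hconst : HasFDerivAt (fun u => g (ψ (z.1, u)))
        (0 : (fderiv ℝ g x₀).ker →L[ℝ] A) z.2 :=
      (hasFDerivAt_const z.1 z.2).congr_of_eventuallyEq <|
        ((Continuous.prodMk_right z.1).tendsto' z.2 z rfl).eventually hz |>.mono
          fun u hu => congrArg Prod.fst hu
    convert! (hκ (ψ z)).hasFDerivAt.comp z.2 hψu using 1
    ext v
    exact (hkz (DFunLike.congr_fun (hgψ.unique hconst) v)).symm
  obtain ⟨N, hN, hconst⟩ := exists_nhds_eq_of_hasFDerivAt_snd_zero (F := κ ∘ ψ) hfibre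
  have hcont : ContinuousAt (fun x => (g x, π x)) x₀ :=
    (hg.continuous.prodMk π.continuous).continuousAt
  refine ⟨_, inter_mem hleft (hcont hN), ?_⟩
  rintro x ⟨hx, hxN⟩ x' ⟨hx', hxN'⟩ hgx
  rw [← show ψ (g x, π x) = x from hx, ← show ψ (g x', π x') = x' from hx']
  exact hconst _ hxN _ hxN' hgx

theorem eventually_range_eq_top [FiniteDimensional ℝ A] {T : X → X →L[ℝ] A} {x₀ : X}
    (hT : ContinuousAt T x₀) (hsurj : (T x₀).range = ⊤) : ∀ᶠ x in 𝓝 x₀, (T x).range = ⊤ := by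
  have := FiniteDimensional.complete ℝ A
  obtain ⟨R, hR⟩ := (T x₀).exists_rightInverse_of_surjective hsurj
  have hunit : ∀ᶠ x in 𝓝 x₀, IsUnit ((T x).comp R) :=
    (hT.clm_comp continuousAt_const).eventually
      (Units.isOpen.mem_nhds (hR.symm ▸ isUnit_one : IsUnit ((T x₀).comp R)))
  filter_upwards [hunit] with x hx
  obtain ⟨S, hS⟩ := hx.exists_right_inv
  exact LinearMap.range_eq_top.2 fun a => ⟨R (S a), DFunLike.congr_fun hS a⟩

theorem exists_comp_fderiv_range_eq_top [FiniteDimensional ℝ X] {g : X → A} {x₀ : X}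
    (hg : Differentiable ℝ g) :
    ∃ P : A →L[ℝ] (fderiv ℝ g x₀).range, (fderiv ℝ (P ∘ g) x₀).range = ⊤ ∧
      (fderiv ℝ (P ∘ g) x₀).ker ≤ (fderiv ℝ g x₀).ker ∧
      ∀ x, fderiv ℝ (P ∘ g) x = P.comp (fderiv ℝ g x) := by
  obtain ⟨P, hP⟩ := Submodule.ClosedComplemented.of_finiteDimensional (fderiv ℝ g x₀).range
  have hPg (x : X) : fderiv ℝ (P ∘ g) x = P.comp (fderiv ℝ g x) :=
    (P.hasFDerivAt.comp x (hg x).hasFDerivAt).fderiv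
  have hPg₀ (w : X) : fderiv ℝ (P ∘ g) x₀ w = ⟨fderiv ℝ g x₀ w, w, rfl⟩ := by
    rw [hPg]
    exact hP ⟨_, w, rfl⟩
  exact ⟨P, LinearMap.range_eq_top.2 fun ⟨_, w, hw⟩ => ⟨w, (hPg₀ w).trans (Subtype.ext hw)⟩,
    fun w hw => congrArg Subtype.val ((hPg₀ w).symm.trans hw), hPg⟩

variable [FiniteDimensional ℝ X]

-- This is the constant rank theorem: the composite of `g` with a projection to the range of its
-- derivative at `x₀` is a submersion.
theorem exists_nhds_eq_of_ker_le {g : X → A} {κ : X → B} {x₀ : X}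
    (hg : ContDiff ℝ 1 g) (hκ : Differentiable ℝ κ)
    (h₀ : (fderiv ℝ g x₀).ker ≤ (fderiv ℝ κ x₀).ker)
    (hker : ∀ᶠ x in 𝓝 x₀, (fderiv ℝ κ x).ker ≤ (fderiv ℝ g x).ker)
    (hrank : ∀ᶠ x in 𝓝 x₀,
      Module.finrank ℝ (fderiv ℝ κ x₀).ker ≤ Module.finrank ℝ (fderiv ℝ κ x).ker) :
    ∃ N ∈ 𝓝 x₀, ∀ x ∈ N, ∀ x' ∈ N, g x = g x' → κ x = κ x' := by
  have := FiniteDimensional.complete ℝ X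
  obtain ⟨P, hsurj, hker₀, hP⟩ :=
    exists_comp_fderiv_range_eq_top (x₀ := x₀) (hg.differentiable one_ne_zero)
  have hPg : ContDiff ℝ 1 (P ∘ g) := P.contDiff.comp hg
  obtain ⟨N, hN, h⟩ := exists_nhds_eq_of_ker_le_of_range_eq_top hPg hκ hsurj <| by
    filter_upwards [hker, hrank, eventually_range_eq_top
      (hPg.continuous_fderiv one_ne_zero).continuousAt hsurj] with x hkx hrx hsx
    have hle : (fderiv ℝ κ x).ker ≤ (fderiv ℝ (P ∘ g) x).ker :=
      hP x ▸ hkx.trans (LinearMap.ker_le_ker_comp _ _)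
    refine (Submodule.eq_of_le_of_finrank_le hle ?_).ge
    have hx := (fderiv ℝ (P ∘ g) x).toLinearMap.finrank_range_add_finrank_ker
    have hx₀ := (fderiv ℝ (P ∘ g) x₀).toLinearMap.finrank_range_add_finrank_ker
    have hmono := Submodule.finrank_mono (hker₀.trans h₀)
    rw [hsx] at hx
    rw [hsurj] at hx₀
    omega
  exact ⟨N, hN, fun x hx x' hx' hgx => h x hx x' hx' (congrArg P hgx)⟩

theorem exists_continuousAt_section {f : X → A} {l : X → ℝ} {x₀ w : X} (hf : ContDiff ℝ 1 f)
    (hl : ContDiff ℝ 1 l)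
    (hrank : ∀ᶠ x in 𝓝 x₀,
      Module.finrank ℝ (fderiv ℝ f x₀).ker ≤ Module.finrank ℝ (fderiv ℝ f x).ker)
    (hfw : fderiv ℝ f x₀ w = 0) (hlw : fderiv ℝ l x₀ w ≠ 0) :
    ∃ σ : ℝ → X, σ (l x₀) = x₀ ∧
      ∀ᶠ t in 𝓝 (l x₀), ContinuousAt σ t ∧ f (σ t) = f x₀ ∧ l (σ t) = t := by
  have := FiniteDimensional.complete ℝ X
  obtain ⟨P, hsurjP, hker₀, hP⟩ :=
    exists_comp_fderiv_range_eq_top (x₀ := x₀) (hf.differentiable one_ne_zero)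
  have hPf : ContDiff ℝ 1 (P ∘ f) := P.contDiff.comp hf
  -- On `N` the fibres of the submersion `P ∘ f` are those of `f`.
  obtain ⟨N, hN, hPN⟩ := exists_nhds_eq_of_ker_le hPf (hf.differentiable one_ne_zero) hker₀
    (Eventually.of_forall fun x => hP x ▸ LinearMap.ker_le_ker_comp _ _) hrank
  let g : X → (fderiv ℝ f x₀).range × ℝ := fun x => (P (f x), l x)
  have hg : ContDiff ℝ 1 g := hPf.prodMk hl
  have hg' : fderiv ℝ g x₀ = (fderiv ℝ (P ∘ f) x₀).prod (fderiv ℝ l x₀) :=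
    (hPf.differentiable one_ne_zero x₀).fderiv_prodMk (hl.differentiable one_ne_zero x₀)
  have hsurj : (fderiv ℝ g x₀).range = ⊤ := by
    refine LinearMap.range_eq_top.2 fun ⟨a, t⟩ => ?_
    obtain ⟨v, rfl⟩ := LinearMap.range_eq_top.1 hsurjP a
    refine ⟨v + ((t - fderiv ℝ l x₀ v) / fderiv ℝ l x₀ w) • w, ?_⟩
    simp [hg', hP, hfw, hlw]
  obtain ⟨π, ψ, hψ, hψ₀, hright, -⟩ := exists_localInverse_prodMk hg hsurj
  have hψN : ∀ᶠ z in 𝓝 (g x₀, π x₀), ψ z ∈ N := by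
    have := hψ.continuousAt.tendsto
    rw [hψ₀] at this
    exact this.eventually hN
  let ι (t : ℝ) : ((fderiv ℝ f x₀).range × ℝ) × (fderiv ℝ g x₀).ker := ((P (f x₀), t), π x₀)
  have hι : Continuous ι := by fun_prop
  refine ⟨ψ ∘ ι, hψ₀, ?_⟩
  filter_upwards [(hι.tendsto (l x₀)).eventually hright, (hι.tendsto (l x₀)).eventually hψN,
    (hι.tendsto (l x₀)).eventually (hψ.eventually (by simp))] with t hrt hNt hct
  have hgt : g (ψ (ι t)) = (P (f x₀), t) := congrArg Prod.fst hrt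
  exact ⟨hct.continuousAt.comp hι.continuousAt,
    hPN _ hNt _ (mem_of_mem_nhds hN) (congrArg Prod.fst hgt), congrArg Prod.snd hgt⟩

theorem exists_nhds_eq_of_coordinate {f : X → A} {κ : X → B} {x₀ w : X} {l : B →L[ℝ] ℝ}
    (hf : ContDiff ℝ 1 f) (hκ : ContDiff ℝ 1 κ)
    (hker : ∀ x, (fderiv ℝ κ x).ker ≤ (fderiv ℝ f x).ker)
    (hrank : ∀ x, Module.finrank ℝ (fderiv ℝ κ x₀).ker ≤ Module.finrank ℝ (fderiv ℝ κ x).ker)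
    (hdim : Module.finrank ℝ (fderiv ℝ f x₀).ker ≤ Module.finrank ℝ (fderiv ℝ κ x₀).ker + 1)
    (hfw : fderiv ℝ f x₀ w = 0) (hlw : l (fderiv ℝ κ x₀ w) ≠ 0) :
    ∃ N ∈ 𝓝 x₀, ∀ x ∈ N, ∀ x' ∈ N, f x = f x' → l (κ x) = l (κ x') → κ x = κ x' := by
  have hderiv (x : X) : fderiv ℝ (fun x => (f x, l (κ x))) x =
      (fderiv ℝ f x).prod (l.comp (fderiv ℝ κ x)) :=
    ((hf.differentiable one_ne_zero x).hasFDerivAt.prodMk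
      (l.hasFDerivAt.comp x (hκ.differentiable one_ne_zero x).hasFDerivAt)).fderiv
  have hle (x : X) : (fderiv ℝ κ x).ker ≤ (fderiv ℝ (fun x => (f x, l (κ x))) x).ker := by
    intro v hv
    have hfv : fderiv ℝ f x v = 0 := hker x hv
    have hκv : fderiv ℝ κ x v = 0 := hv
    simp [hderiv, hfv, hκv]
  have hlt : (fderiv ℝ (fun x => (f x, l (κ x))) x₀).ker < (fderiv ℝ f x₀).ker := by
    rw [hderiv]
    exact lt_of_le_of_ne (fun v hv => congrArg Prod.fst hv)
      fun heq => hlw (congrArg Prod.snd (heq.ge hfw))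
  have heq := Submodule.eq_of_le_of_finrank_le (hle x₀) <| by
    have := Submodule.finrank_lt_finrank_of_lt hlt
    omega
  obtain ⟨N, hN, h⟩ := exists_nhds_eq_of_ker_le (hf.prodMk (l.contDiff.comp hκ))
    (hκ.differentiable one_ne_zero) heq.ge (Eventually.of_forall hle) (Eventually.of_forall hrank)
  exact ⟨N, hN, fun x hx x' hx' hfx hlx => h x hx x' hx' (Prod.ext hfx hlx)⟩

end ConstantRank

section CutPoint

variable {Y : Type*} [TopologicalSpace Y] {y z : Y} {A B : Set Y}

/-- The complement of the point `y` is the union of the disjoint nonempty open sets `A` and `B`. -/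
structure IsSeparation (y : Y) (A B : Set Y) : Prop where
  isOpen_left : IsOpen A
  isOpen_right : IsOpen B
  disjoint : Disjoint A B
  union_eq : A ∪ B = {y}ᶜ
  nonempty_left : A.Nonempty
  nonempty_right : B.Nonempty

/-- A cut point of `Y`: a point whose complement is disconnected. -/
def IsCutPoint (y : Y) : Prop :=
  ∃ A B, IsSeparation y A B

namespace IsSeparation

theorem symm (h : IsSeparation y A B) : IsSeparation y B A :=
  ⟨h.isOpen_right, h.isOpen_left, h.disjoint.symm, union_comm A B ▸ h.union_eq, h.nonempty_right,
    h.nonempty_left⟩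

theorem mem_union (h : IsSeparation y A B) (hz : z ≠ y) : z ∈ A ∪ B :=
  h.union_eq ▸ hz

theorem notMem_left (h : IsSeparation y A B) : y ∉ A := fun hy =>
  (h.union_eq ▸ Or.inl hy : y ∈ ({y}ᶜ : Set Y)) rfl

theorem insert_left_eq_compl (h : IsSeparation y A B) : insert y A = Bᶜ := by
  rw [insert_eq, ← compl_compl ({y} : Set Y), ← h.union_eq, compl_union]
  have := h.disjoint.subset_compl_right
  grind

theorem isClosed_insert_left (h : IsSeparation y A B) : IsClosed (insert y A) :=
  h.insert_left_eq_compl ▸ h.isOpen_right.isClosed_compl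

theorem isPreconnected_insert_left [PreconnectedSpace Y] (h : IsSeparation y A B) :
    IsPreconnected (insert y A) := by
  refine (isPreconnected_iff_subset_of_fully_disjoint_closed h.isClosed_insert_left).2
    fun u v hu hv huv hdisj => ?_
  wlog hyu : y ∈ u generalizing u v
  · exact (this v u hv hu (union_comm u v ▸ huv) hdisj.symm
      ((huv (mem_insert _ _)).resolve_left hyu)).symm
  have hv_eq : insert y A ∩ v = A ∩ uᶜ := by
    ext x
    have := @huv x
    have := hdisj.notMem_of_mem_left (a := x)
    grind [mem_union]
  have hclopen : IsClopen (insert y A ∩ v) :=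
    ⟨h.isClosed_insert_left.inter hv, hv_eq ▸ h.isOpen_left.inter hu.isOpen_compl⟩
  rcases isClopen_iff.1 hclopen with hempty | huniv
  · exact .inl fun x hx => (huv hx).resolve_right fun hxv => hempty.subset ⟨hx, hxv⟩
  · exact (hdisj.notMem_of_mem_left hyu (huniv ▸ mem_univ y : y ∈ insert y A ∩ v).2).elim

theorem mem_closure_right [PreconnectedSpace Y] (h : IsSeparation y A B) : y ∈ closure B := by
  by_contra hy
  have hclosed : IsClosed B := isClosed_of_closure_subset fun x hx => by
    have hx' : x ∈ insert y B :=
      h.symm.isClosed_insert_left.closure_subset_iff.2 (subset_insert _ _) hx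
    exact hx'.resolve_left (ne_of_mem_of_not_mem hx hy)
  rcases isClopen_iff.1 ⟨hclosed, h.isOpen_right⟩ with hB | hB
  · exact h.nonempty_right.ne_empty hB
  · exact h.symm.notMem_left (hB ▸ mem_univ y)

/-- Two separations are nested: `insert z A` is connected and avoids `w ∈ B`. -/
theorem insert_right_subset [PreconnectedSpace Y] {w y₀ : Y} {A' B' : Set Y}
    (h : IsSeparation z A B) (h' : IsSeparation w A' B') (hw : w ∈ B) (hy₀ : y₀ ∈ A)
    (hy₀' : y₀ ∈ A') : insert w B' ⊆ B := by
  have hw' : w ∉ insert z A := h.insert_left_eq_compl ▸ fun h => h hw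
  have hsub : insert z A ⊆ A' :=
    h.isPreconnected_insert_left.subset_left_of_subset_union h'.isOpen_left h'.isOpen_right
      h'.disjoint (fun x hx => h'.mem_union (ne_of_mem_of_not_mem hx hw'))
      ⟨y₀, mem_insert_of_mem _ hy₀, hy₀'⟩
  rw [h'.symm.insert_left_eq_compl, compl_subset_comm, ← h.insert_left_eq_compl]
  exact hsub

theorem preimage_val {K : Set Y} {z : K} (h : IsSeparation (z : Y) A B) (hA : (K ∩ A).Nonempty)
    (hB : (K ∩ B).Nonempty) :
    IsSeparation z ((↑) ⁻¹' A : Set K) ((↑) ⁻¹' B : Set K) where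
  isOpen_left := h.isOpen_left.preimage continuous_subtype_val
  isOpen_right := h.isOpen_right.preimage continuous_subtype_val
  disjoint := h.disjoint.preimage _
  union_eq := by
    rw [← preimage_union, h.union_eq]
    ext x
    exact not_congr Subtype.ext_iff.symm
  nonempty_left := let ⟨x, hx⟩ := hA; ⟨⟨x, hx.1⟩, hx.2⟩
  nonempty_right := let ⟨x, hx⟩ := hB; ⟨⟨x, hx.1⟩, hx.2⟩

end IsSeparation

theorem IsCutPoint.exists_isSeparation_mem_left (hz : IsCutPoint z) (hyz : y ≠ z) :
    ∃ A B, IsSeparation z A B ∧ y ∈ A := by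
  obtain ⟨A, B, h⟩ := hz
  exact (h.mem_union hyz).elim (fun hA => ⟨A, B, h, hA⟩) fun hB => ⟨B, A, h.symm, hB⟩

theorem exists_minimal_of_isClosed_of_mem_imp_subset {X : Type*} [TopologicalSpace X]
    [CompactSpace X] {I : Set X} (hI : I.Nonempty) {C : X → Set X}
    (hclosed : ∀ z ∈ I, IsClosed (C z)) (hself : ∀ z ∈ I, z ∈ C z)
    (hsub : ∀ z ∈ I, ∀ w ∈ C z, w ∈ I ∧ C w ⊆ C z) :
    ∃ m ∈ I, ∀ w ∈ C m, C m ⊆ C w := by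
  obtain ⟨z₀, hz₀⟩ := hI
  suffices hchain : ∀ c ⊆ C '' I, IsChain (· ⊆ ·) c → c.Nonempty →
      ∃ lb ∈ C '' I, ∀ D ∈ c, lb ⊆ D by
    obtain ⟨_, -, hmin⟩ :=
      zorn_superset_nonempty (C '' I) hchain (C z₀) (mem_image_of_mem C hz₀)
    obtain ⟨m, hm, rfl⟩ := hmin.prop
    exact ⟨m, hm, fun w hw => hmin.le_of_le
      (mem_image_of_mem C (hsub m hm w hw).1) (hsub m hm w hw).2⟩
  intro c hcI hc hne
  have := hne.to_subtype
  have hclosed' : ∀ D ∈ c, IsClosed D := fun D hD => by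
    obtain ⟨z, hz, rfl⟩ := hcI hD
    exact hclosed z hz
  obtain ⟨w, hw⟩ := IsCompact.nonempty_sInter_of_directed_nonempty_isCompact_isClosed
    (fun s hs t ht => (hc.total hs ht).elim (fun hst => ⟨s, hs, Subset.rfl, hst⟩)
      fun hts => ⟨t, ht, hts, Subset.rfl⟩)
    (fun D hD => by obtain ⟨z, hz, rfl⟩ := hcI hD; exact ⟨z, hself z hz⟩)
    (fun D hD => (hclosed' D hD).isCompact) hclosed'
  have hwD : ∀ D ∈ c, w ∈ I ∧ C w ⊆ D := fun D hD => by
    obtain ⟨z, hz, rfl⟩ := hcI hD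
    exact hsub z hz w (hw _ hD)
  obtain ⟨D, hD⟩ := hne
  exact ⟨C w, mem_image_of_mem C (hwD D hD).1, fun D hD => (hwD D hD).2⟩

theorem exists_ne_not_isCutPoint [CompactSpace Y] [PreconnectedSpace Y] [Nontrivial Y] (y₀ : Y) :
    ∃ z ≠ y₀, ¬ IsCutPoint z := by
  by_contra! hcut
  choose! A B h hA using fun z hz => (hcut z hz).exists_isSeparation_mem_left (Ne.symm hz)
  -- The sides `insert z (B z)` away from `y₀` have no minimal element: cutting at a point of
  -- `B z` produces a smaller one.
  have hB (z : Y) (hz : z ≠ y₀) (w : Y) (hw : w ∈ B z) : w ≠ y₀ ∧ insert w (B w) ⊆ B z := by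
    have hwy₀ : w ≠ y₀ := fun hwy₀ => (h z hz).disjoint.notMem_of_mem_left (hA z hz) (hwy₀ ▸ hw)
    exact ⟨hwy₀, (h z hz).insert_right_subset (h w hwy₀) hw (hA z hz) (hA w hwy₀)⟩
  obtain ⟨m, hm, hmin⟩ := exists_minimal_of_isClosed_of_mem_imp_subset (I := {y₀}ᶜ)
    (C := fun z => insert z (B z)) (exists_ne y₀)
    (fun z hz => (h z hz).symm.isClosed_insert_left) (fun z _ => mem_insert _ _) <| by
      rintro z hz w (rfl | hw)
      · exact ⟨hz, Subset.rfl⟩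
      · exact ⟨(hB z hz w hw).1, (hB z hz w hw).2.trans (subset_insert _ _)⟩
  obtain ⟨w, hw⟩ := (h m hm).nonempty_right
  obtain ⟨-, hwB⟩ := hB m hm w hw
  exact (h m hm).symm.notMem_left (hwB (hmin w (mem_insert_of_mem _ hw) (mem_insert _ _)))

end CutPoint

section OneDimensionalManifold

variable {Y : Type*} [TopologicalSpace Y]

theorem isPreconnected_source_inter_preimage {φ : OpenPartialHomeomorph Y ℝ}
    (hφ : φ.target.OrdConnected) {s : Set ℝ} (hs : s.OrdConnected) :
    IsPreconnected (φ.source ∩ φ ⁻¹' s) := by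
  rw [← φ.source_inter_preimage_target_inter,
    ← φ.symm_image_eq_source_inter_preimage inter_subset_left]
  exact (hφ.inter hs).isPreconnected.image _ (φ.continuousOn_symm.mono inter_subset_left)

theorem isClosed_source_inter_preimage_Icc [T2Space Y] {φ : OpenPartialHomeomorph Y ℝ} {a b : ℝ}
    (hab : Icc a b ⊆ φ.target) : IsClosed (φ.source ∩ φ ⁻¹' Icc a b) := by
  rw [← φ.symm_image_eq_source_inter_preimage hab]
  exact (isCompact_Icc.image_of_continuousOn (φ.continuousOn_symm.mono hab)).isClosed

theorem IsCutPoint.exists_isSeparation_of_chart [PreconnectedSpace Y] {z : Y}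
    (hz : IsCutPoint z) {φ : OpenPartialHomeomorph Y ℝ} (hφ : φ.target.OrdConnected)
    (hzφ : z ∈ φ.source) :
    ∃ A B, IsSeparation z A B ∧ φ.source ∩ φ ⁻¹' Iio (φ z) ⊆ A ∧
      φ.source ∩ φ ⁻¹' Ioi (φ z) ⊆ B := by
  obtain ⟨A, B, h⟩ := hz
  have hside {s : Set ℝ} (hs : s.OrdConnected) (hzs : φ z ∉ s) :
      φ.source ∩ φ ⁻¹' s ⊆ A ∨ φ.source ∩ φ ⁻¹' s ⊆ B :=
    (isPreconnected_source_inter_preimage hφ hs).subset_or_subset h.isOpen_left h.isOpen_right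
      h.disjoint fun x hx => h.mem_union fun hxz => hzs (hxz ▸ hx.2)
  -- If both half-arcs at `z` lay in one side, then `z` would not be in the closure of the other.
  have hnot {A B : Set Y} (h : IsSeparation z A B) (hl : φ.source ∩ φ ⁻¹' Iio (φ z) ⊆ A)
      (hr : φ.source ∩ φ ⁻¹' Ioi (φ z) ⊆ A) : False := by
    obtain ⟨x, hxφ, hxB⟩ :=
      mem_closure_iff.1 h.mem_closure_right _ φ.open_source hzφ
    have hxz : φ x ≠ φ z := fun hxz =>
      h.symm.notMem_left (φ.injOn hxφ hzφ hxz ▸ hxB)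
    exact h.disjoint.notMem_of_mem_right hxB
      (hxz.lt_or_gt.elim (fun hlt => hl ⟨hxφ, hlt⟩) fun hgt => hr ⟨hxφ, hgt⟩)
  rcases hside ordConnected_Iio self_notMem_Iio, hside ordConnected_Ioi self_notMem_Ioi with
    ⟨hl | hl, hr | hr⟩
  · exact (hnot h hl hr).elim
  · exact ⟨A, B, h, hl, hr⟩
  · exact ⟨B, A, h.symm, hl, hr⟩
  · exact (hnot h.symm hl hr).elim

-- The arc from `z` to `z'` moves from the right-hand side to the left-hand side.
theorem IsSeparation.shift_of_chart [T2Space Y] {z z' : Y} {A B : Set Y}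
    (h : IsSeparation z A B) {φ : OpenPartialHomeomorph Y ℝ} (hφ : φ.target.OrdConnected)
    (hzφ : z ∈ φ.source) (hzφ' : z' ∈ φ.source) (hlt : φ z < φ z')
    (hl : φ.source ∩ φ ⁻¹' Iio (φ z) ⊆ A) (hr : φ.source ∩ φ ⁻¹' Ioi (φ z) ⊆ B) :
    IsSeparation z' (A ∪ φ.source ∩ φ ⁻¹' Iio (φ z'))
      (B \ (φ.source ∩ φ ⁻¹' Icc (φ z) (φ z'))) := by
  have hclosed : IsClosed (φ.source ∩ φ ⁻¹' Icc (φ z) (φ z')) :=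
    isClosed_source_inter_preimage_Icc (hφ.out (φ.map_source hzφ) (φ.map_source hzφ'))
  refine ⟨h.isOpen_left.union (φ.isOpen_inter_preimage isOpen_Iio),
    h.isOpen_right.sdiff hclosed, ?_, ?_, h.nonempty_left.inl, ?_⟩
  · refine disjoint_left.2 ?_
    rintro x (hxA | ⟨hxφ, hxlt⟩) ⟨hxB, hx⟩
    · exact h.disjoint.notMem_of_mem_left hxA hxB
    · have hxz : φ x < φ z := not_le.1 fun hle => hx ⟨hxφ, hle, le_of_lt hxlt⟩
      exact h.disjoint.notMem_of_mem_left (hl ⟨hxφ, hxz⟩) hxB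
  · have hz'B : z' ∈ B := hr ⟨hzφ', hlt⟩
    refine Subset.antisymm ?_ fun x hx => ?_
    · rintro x ((hxA | ⟨-, hxlt⟩) | ⟨-, hx⟩) rfl
      · exact h.disjoint.notMem_of_mem_left hxA hz'B
      · exact lt_irrefl (φ x) hxlt
      · exact hx ⟨hzφ', hlt.le, le_rfl⟩
    · by_cases hxarc : x ∈ φ.source ∩ φ ⁻¹' Icc (φ z) (φ z')
      · have hxlt : φ x < φ z' :=
          lt_of_le_of_ne hxarc.2.2 fun hxz => hx (φ.injOn hxarc.1 hzφ' hxz)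
        exact .inl (.inr ⟨hxarc.1, hxlt⟩)
      · have hxz : x ≠ z := by
          rintro rfl
          exact hxarc ⟨hzφ, le_rfl, hlt.le⟩
        exact (h.mem_union hxz).imp .inl fun hxB => ⟨hxB, hxarc⟩
  · obtain ⟨t, ht, htφ⟩ :=
      Filter.Eventually.exists_gt (φ.open_target.mem_nhds (φ.map_source hzφ'))
    have hφt : φ (φ.symm t) = t := φ.right_inv htφ
    refine ⟨φ.symm t, hr ⟨φ.map_target htφ, ?_⟩, fun hmem => ?_⟩
    · exact hlt.trans (ht.trans_eq hφt.symm)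
    · exact ht.not_ge (hφt.symm.le.trans hmem.2.2)

theorem IsCutPoint.of_chart [T2Space Y] [PreconnectedSpace Y] {z z' : Y} (hz : IsCutPoint z)
    {φ : OpenPartialHomeomorph Y ℝ} (hφ : φ.target.OrdConnected) (hzφ : z ∈ φ.source)
    (hzφ' : z' ∈ φ.source) : IsCutPoint z' := by
  wlog hlt : φ z < φ z' generalizing φ
  · rcases (not_lt.1 hlt).eq_or_lt with heq | hgt
    · exact φ.injOn hzφ hzφ' heq.symm ▸ hz
    · refine this (φ := φ.transHomeomorph (Homeomorph.neg ℝ)) ?_ hzφ hzφ' (neg_lt_neg hgt)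
      exact hφ.preimage_anti fun _ _ => neg_le_neg
  obtain ⟨A, B, h, hl, hr⟩ := hz.exists_isSeparation_of_chart hφ hzφ
  exact ⟨_, _, h.shift_of_chart hφ hzφ hzφ' hlt hl hr⟩

theorem not_isLocalExtr_of_section {h : Y → ℝ} {θ : ℝ → Y} {y₀ : Y} (hθ₀ : θ (h y₀) = y₀)
    (hθ : ContinuousAt θ (h y₀)) (hsec : ∀ᶠ t in 𝓝 (h y₀), h (θ t) = t) :
    ¬ IsLocalExtr h y₀ := fun hextr => by
  have hid : IsLocalExtr id (h y₀) := by
    rw [← hθ₀] at hextr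
    exact (hextr.comp_continuous hθ).congr hsec
  exact one_ne_zero (hid.hasDerivAt_eq_zero (hasDerivAt_id _))

theorem exists_openPartialHomeomorph_of_section {X : Type*} [TopologicalSpace X] {χ : Y → X}
    {θ : X → Y} {y₀ : Y} {U : Set Y} (hχ : Continuous χ) (hU : U ∈ 𝓝 y₀) (hinj : InjOn χ U)
    (hθ₀ : θ (χ y₀) = y₀) (hθ : ∀ᶠ t in 𝓝 (χ y₀), ContinuousAt θ t ∧ χ (θ t) = t) :
    ∃ e : OpenPartialHomeomorph Y X, y₀ ∈ e.source := by
  wlog hUo : IsOpen U generalizing U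
  · exact this (interior_mem_nhds.2 hU) (hinj.mono interior_subset) isOpen_interior
  have hθU : ∀ᶠ t in 𝓝 (χ y₀), θ t ∈ U := by
    have htendsto := hθ.self_of_nhds.1.tendsto
    rw [hθ₀] at htendsto
    exact htendsto.eventually hU
  obtain ⟨J, hJ, hJo, hy₀J⟩ := eventually_nhds_iff.1 (hθ.and hθU)
  exact ⟨{
    toFun := χ
    invFun := θ
    source := U ∩ χ ⁻¹' J
    target := J
    map_source' := fun y hy => hy.2
    map_target' := fun t ht => ⟨(hJ t ht).2, mem_preimage.2 ((hJ t ht).1.2.symm ▸ ht)⟩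
    left_inv' := fun y hy => hinj (hJ _ hy.2).2 hy.1 (hJ _ hy.2).1.2
    right_inv' := fun t ht => (hJ t ht).1.2
    open_source := hUo.inter (hJo.preimage hχ)
    open_target := hJo
    continuousOn_toFun := hχ.continuousOn
    continuousOn_invFun := fun t ht => (hJ t ht).1.1.continuousWithinAt },
    mem_of_mem_nhds hU, hy₀J⟩

variable [ChartedSpace ℝ Y]

variable (Y) in
theorem isLocallyConstant_isCutPoint [T2Space Y] [PreconnectedSpace Y] :
    IsLocallyConstant (IsCutPoint : Y → Prop) := by
  refine (IsLocallyConstant.iff_eventually_eq _).2 fun y => ?_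
  obtain ⟨ε, hε, hball⟩ := Metric.mem_nhds_iff.1 (chart_target_mem_nhds ℝ y)
  let φ : OpenPartialHomeomorph Y ℝ :=
    ((chartAt ℝ y).symm.restrOpen (Metric.ball (chartAt ℝ y y) ε) Metric.isOpen_ball).symm
  have htarget : φ.target = Metric.ball (chartAt ℝ y y) ε := inter_eq_right.2 hball
  have hφ : φ.target.OrdConnected := by
    rw [htarget, Real.ball_eq_Ioo]
    exact ordConnected_Ioo
  have hy : y ∈ φ.source :=
    ⟨mem_chart_source ℝ y, Metric.mem_ball_self hε⟩
  filter_upwards [φ.open_source.mem_nhds hy] with z hz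
  exact propext ⟨fun h => h.of_chart hφ hz hy, fun h => h.of_chart hφ hy hz⟩

theorem exists_ne_eq_of_not_isLocalExtr_of_preconnectedSpace [T2Space Y] [PreconnectedSpace Y]
    {h : Y → ℝ} {y₀ : Y} (hh : Continuous h) (hcpt : IsCompact {y | h y ≤ h y₀})
    (hextr : ¬ IsLocalExtr h y₀) : ∃ y ≠ y₀, h y = h y₀ := by
  by_contra! hne
  have hsep : IsSeparation y₀ {y | h y < h y₀} {y | h y₀ < h y} := by
    refine ⟨isOpen_lt hh continuous_const, isOpen_lt continuous_const hh,
      disjoint_left.2 fun y => lt_asymm (a := h y), ?_, ?_, ?_⟩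
    · ext y
      exact lt_or_lt_iff_ne.trans ⟨fun hy heq => hy (congrArg h heq), hne y⟩
    · by_contra! hempty
      exact hextr (.inl (.of_forall fun y => not_lt.1 fun hy => hempty.subset hy))
    · by_contra! hempty
      exact hextr (.inr (.of_forall fun y => not_lt.1 fun hy => hempty.subset hy))
  have hcut (z : Y) : IsCutPoint z :=
    ((isLocallyConstant_isCutPoint Y).apply_eq_of_preconnectedSpace y₀ z).mp ⟨_, _, hsep⟩
  let K := insert y₀ {y | h y < h y₀}
  have := Subtype.preconnectedSpace hsep.isPreconnected_insert_left
  have : CompactSpace K := isCompact_iff_compactSpace.1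
    (hcpt.of_isClosed_subset hsep.isClosed_insert_left
      (insert_subset (le_refl (h y₀)) fun _ => le_of_lt (α := ℝ)))
  obtain ⟨a, ha⟩ := hsep.nonempty_left
  have : Nontrivial K := ⟨⟨a, .inr ha⟩, ⟨y₀, .inl rfl⟩, fun hay₀ => ha.ne (congrArg (h ·.1) hay₀)⟩
  obtain ⟨⟨z, hzK⟩, hzy₀, hz⟩ := exists_ne_not_isCutPoint (⟨y₀, .inl rfl⟩ : K)
  have hzy₀' : z ≠ y₀ := fun heq => hzy₀ (Subtype.ext heq)
  obtain ⟨P, Q, hPQ, hP⟩ := (hcut z).exists_isSeparation_mem_left hzy₀'.symm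
  -- `z` is an interior point of `K` and a limit of `Q`, so `P` and `Q` also separate `K`.
  obtain ⟨x, hx, hxQ⟩ := mem_closure_iff.1 hPQ.mem_closure_right _ hsep.isOpen_left
    (hzK.resolve_left hzy₀')
  exact hz ⟨_, _, hPQ.preimage_val (K := K) ⟨y₀, .inl rfl, hP⟩ ⟨x, .inr hx, hxQ⟩⟩

theorem exists_ne_eq_of_not_isLocalExtr [T2Space Y] {h : Y → ℝ} {y₀ : Y} (hh : Continuous h)
    (hcpt : IsCompact {y | h y ≤ h y₀}) (hextr : ¬ IsLocalExtr h y₀) :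
    ∃ y ≠ y₀, h y = h y₀ := by
  have := ChartedSpace.locallyConnectedSpace ℝ Y
  let C : TopologicalSpace.Opens Y := ⟨connectedComponent y₀, isOpen_connectedComponent⟩
  let c₀ : C := ⟨y₀, mem_connectedComponent⟩
  have : PreconnectedSpace C := Subtype.preconnectedSpace isPreconnected_connectedComponent
  have hcpt' : IsCompact {y : C | h y ≤ h c₀} :=
    isClosed_connectedComponent.isClosedEmbedding_subtypeVal.isCompact_preimage hcpt
  have hmap : map ((↑) : C → Y) (𝓝 c₀) = 𝓝 y₀ :=
    map_nhds_subtype_coe_eq_nhds _ (C.2.mem_nhds c₀.2)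
  have hextr' : ¬ IsLocalExtr (fun y : C => h y) c₀ := fun hloc => hextr <| by
    rw [IsLocalExtr, ← hmap]
    exact hloc
  obtain ⟨y, hne, hy⟩ := exists_ne_eq_of_not_isLocalExtr_of_preconnectedSpace
    (hh.comp continuous_subtype_val) hcpt' hextr'
  exact ⟨y, fun heq => hne (Subtype.ext heq), hy⟩

end OneDimensionalManifold

section FibreModulo

/-- The fibre of `f` over `a`, modulo the relation `κ x = κ x'`. For `κ` the vector of all squared
lengths, this is the space of congruence classes of realizations with prescribed edge lengths. -/
def fibreModulo {X A B : Type*} (f : X → A) (κ : X → B) (a : A) :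
    Set (Quotient (Setoid.ker κ)) :=
  Quotient.mk _ '' (f ⁻¹' {a})

theorem t2Space_quotient_ker {X B : Type*} [TopologicalSpace X] [TopologicalSpace B] [T2Space B]
    {κ : X → B} (hκ : Continuous κ) : T2Space (Quotient (Setoid.ker κ)) :=
  .of_injective_continuous (Setoid.kerLift_injective κ) (hκ.quotient_lift fun _ _ h => h)

theorem isCompact_sublevel_fibreModulo {X A B : Type*} [TopologicalSpace X] [TopologicalSpace A]
    [T1Space A] {f : X → A} {κ : X → B} {h : X → ℝ} {a : A} {c : ℝ} {K : Set X}
    (hf : Continuous f) (hh : Continuous h) (hfκ : ∀ x x', κ x = κ x' → f x = f x')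
    (hhκ : ∀ x x', κ x = κ x' → h x = h x') (hK : IsCompact K)
    (hsub : ∀ x, f x = a → h x ≤ c → ∃ x' ∈ K, κ x' = κ x) :
    IsCompact {y : fibreModulo f κ a | Quotient.lift h hhκ y.1 ≤ c} := by
  have himage : Subtype.val '' {y : fibreModulo f κ a | Quotient.lift h hhκ y.1 ≤ c} =
      Quotient.mk (Setoid.ker κ) '' (K ∩ (f ⁻¹' {a} ∩ h ⁻¹' Iic c)) := by
    ext y
    constructor
    · rintro ⟨⟨_, x, hfx, rfl⟩, hhx, rfl⟩
      obtain ⟨x', hx'K, hx'⟩ := hsub x hfx hhx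
      exact ⟨x', ⟨hx'K, (hfκ _ _ hx').trans hfx, (hhκ _ _ hx').trans_le hhx⟩, Quotient.sound hx'⟩
    · rintro ⟨x, ⟨-, hfx, hhx⟩, rfl⟩
      exact ⟨⟨⟦x⟧, mem_image_of_mem _ hfx⟩, hhx, rfl⟩
  rw [Subtype.isCompact_iff, himage]
  exact (hK.inter_right ((isClosed_singleton.preimage hf).inter (isClosed_Iic.preimage hh))).image
    continuous_quotient_mk'

variable {X A B : Type*} [NormedAddCommGroup X] [NormedSpace ℝ X] [FiniteDimensional ℝ X]
  [NormedAddCommGroup A] [NormedSpace ℝ A] {f : X → A} {a : A} {x₀ w : X}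

theorem exists_section_fibreModulo {κ : X → B} {h : X → ℝ} (hf : ContDiff ℝ 1 f)
    (hh : ContDiff ℝ 1 h) (hhκ : ∀ x x', κ x = κ x' → h x = h x')
    (hrank : ∀ x, Module.finrank ℝ (fderiv ℝ f x₀).ker ≤ Module.finrank ℝ (fderiv ℝ f x).ker)
    (hfw : fderiv ℝ f x₀ w = 0) (hhw : fderiv ℝ h x₀ w ≠ 0) :
    ∃ θ : ℝ → fibreModulo f κ (f x₀), θ (h x₀) = ⟨⟦x₀⟧, mem_image_of_mem _ rfl⟩ ∧
      ∀ᶠ t in 𝓝 (h x₀), ContinuousAt θ t ∧ Quotient.lift h hhκ (θ t).1 = t := by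
  classical
  obtain ⟨σ, hσ₀, hσ⟩ := exists_continuousAt_section hf hh (.of_forall hrank) hfw hhw
  let θ (t : ℝ) : fibreModulo f κ (f x₀) :=
    if ht : f (σ t) = f x₀ then ⟨⟦σ t⟧, mem_image_of_mem _ ht⟩
    else ⟨⟦x₀⟧, mem_image_of_mem _ rfl⟩
  have hθ {t : ℝ} (ht : f (σ t) = f x₀) : (θ t).1 = ⟦σ t⟧ := congrArg Subtype.val (dif_pos ht)
  refine ⟨θ, Subtype.ext ((hθ (congrArg f hσ₀)).trans (congrArg _ hσ₀)), ?_⟩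
  filter_upwards [hσ.eventually_nhds] with t ht
  obtain ⟨hcont, hft, hht⟩ := ht.self_of_nhds
  refine ⟨IsInducing.subtypeVal.continuousAt_iff.2 ?_, ?_⟩
  · exact (continuous_quotient_mk'.continuousAt.comp hcont).congr
      (ht.mono fun s hs => (hθ hs.2.1).symm)
  · rw [hθ hft]
    exact hht

variable [NormedAddCommGroup B] [NormedSpace ℝ B] {κ : X → B}

theorem exists_chart_fibreModulo (hf : ContDiff ℝ 1 f) (hκ : ContDiff ℝ 1 κ)
    (hfκ : ∀ x x', κ x = κ x' → f x = f x')
    (hker : ∀ x, (fderiv ℝ κ x).ker ≤ (fderiv ℝ f x).ker)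
    (hopen : IsOpenMap (Quotient.mk (Setoid.ker κ)))
    (hrankf : ∀ x, Module.finrank ℝ (fderiv ℝ f x₀).ker ≤ Module.finrank ℝ (fderiv ℝ f x).ker)
    (hrankκ : ∀ x, Module.finrank ℝ (fderiv ℝ κ x₀).ker ≤ Module.finrank ℝ (fderiv ℝ κ x).ker)
    (hdim : Module.finrank ℝ (fderiv ℝ f x₀).ker = Module.finrank ℝ (fderiv ℝ κ x₀).ker + 1)
    (hx₀ : f x₀ = a) :
    ∃ e : OpenPartialHomeomorph (fibreModulo f κ a) ℝ,
      ⟨⟦x₀⟧, mem_image_of_mem _ hx₀⟩ ∈ e.source := by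
  subst hx₀
  have hnot : ¬ (fderiv ℝ f x₀).ker ≤ (fderiv ℝ κ x₀).ker := fun hle =>
    absurd (Submodule.finrank_mono hle) (by lia)
  obtain ⟨w, hfw, hκw⟩ := SetLike.not_le_iff_exists.1 hnot
  obtain ⟨l, hl⟩ := SeparatingDual.exists_ne_zero (R := ℝ) hκw
  obtain ⟨N, hN, hNκ⟩ := exists_nhds_eq_of_coordinate hf hκ hker hrankκ hdim.le hfw hl
  have hlκ (x x' : X) (h : κ x = κ x') : l (κ x) = l (κ x') := congrArg l h
  obtain ⟨θ, hθ₀, hθ⟩ := exists_section_fibreModulo (x₀ := x₀) hf (l.contDiff.comp hκ) hlκ hrankf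
    hfw (by rwa [fderiv_comp _ l.differentiableAt (hκ.differentiable one_ne_zero x₀), l.fderiv])
  refine exists_openPartialHomeomorph_of_section (U := Subtype.val ⁻¹' (Quotient.mk _ '' N))
    (((l.continuous.comp hκ.continuous).quotient_lift hlκ).comp continuous_subtype_val)
    (continuousAt_subtype_val (hopen.image_mem_nhds hN)) ?_ hθ₀ hθ
  rintro ⟨_, z, hz, rfl⟩ ⟨x, hx, hxz⟩ ⟨_, z', hz', rfl⟩ ⟨x', hx', hxz'⟩ heq
  have hκx : κ x = κ z := Quotient.exact hxz
  have hκx' : κ x' = κ z' := Quotient.exact hxz'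
  have hfx : f x = f x' := by rw [hfκ _ _ hκx, hfκ _ _ hκx', hz, hz']
  have hlx : l (κ x) = l (κ x') := by
    rw [hκx, hκx']
    exact heq
  exact Subtype.ext (Quotient.sound (hκx.symm.trans ((hNκ x hx x' hx' hfx hlx).trans hκx')))

theorem exists_eq_ne_of_fibreModulo_oneDimensional {h : X → ℝ} {K : Set X} (hf : ContDiff ℝ 1 f)
    (hκ : ContDiff ℝ 1 κ) (hh : ContDiff ℝ 1 h) (hfκ : ∀ x x', κ x = κ x' → f x = f x')
    (hhκ : ∀ x x', κ x = κ x' → h x = h x')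
    (hker : ∀ x, (fderiv ℝ κ x).ker ≤ (fderiv ℝ f x).ker)
    (hopen : IsOpenMap (Quotient.mk (Setoid.ker κ)))
    (hrankf : ∀ x, f x = f x₀ → ∀ x',
      Module.finrank ℝ (fderiv ℝ f x).ker ≤ Module.finrank ℝ (fderiv ℝ f x').ker)
    (hrankκ : ∀ x, f x = f x₀ → ∀ x',
      Module.finrank ℝ (fderiv ℝ κ x).ker ≤ Module.finrank ℝ (fderiv ℝ κ x').ker)
    (hdim : ∀ x, f x = f x₀ →
      Module.finrank ℝ (fderiv ℝ f x).ker = Module.finrank ℝ (fderiv ℝ κ x).ker + 1)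
    (hfw : fderiv ℝ f x₀ w = 0) (hhw : fderiv ℝ h x₀ w ≠ 0) (hK : IsCompact K)
    (hsub : ∀ x, f x = f x₀ → h x ≤ h x₀ → ∃ x' ∈ K, κ x' = κ x) :
    ∃ x, f x = f x₀ ∧ h x = h x₀ ∧ κ x ≠ κ x₀ := by
  have := t2Space_quotient_ker hκ.continuous
  have hchart (y : fibreModulo f κ (f x₀)) :
      ∃ e : OpenPartialHomeomorph (fibreModulo f κ (f x₀)) ℝ, y ∈ e.source := by
    obtain ⟨_, x, hx, rfl⟩ := y
    exact exists_chart_fibreModulo hf hκ hfκ hker hopen (hrankf x hx) (hrankκ x hx) (hdim x hx) hx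
  choose chart hchart using hchart
  let _ : ChartedSpace ℝ (fibreModulo f κ (f x₀)) :=
    { atlas := range chart
      chartAt := chart
      mem_chart_source := hchart
      chart_mem_atlas := mem_range_self }
  let y₀ : fibreModulo f κ (f x₀) := ⟨⟦x₀⟧, mem_image_of_mem _ rfl⟩
  let h' (y : fibreModulo f κ (f x₀)) : ℝ := Quotient.lift h hhκ y.1
  have hh' : Continuous h' := (hh.continuous.quotient_lift hhκ).comp continuous_subtype_val
  have hcpt : IsCompact {y | h' y ≤ h' y₀} :=
    isCompact_sublevel_fibreModulo hf.continuous hh.continuous hfκ hhκ hK hsub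
  obtain ⟨θ, hθ₀, hθ⟩ := exists_section_fibreModulo hf hh hhκ (hrankf x₀ rfl) hfw hhw
  have hextr : ¬ IsLocalExtr h' y₀ :=
    not_isLocalExtr_of_section hθ₀ hθ.self_of_nhds.1 (hθ.mono fun _ => And.right)
  obtain ⟨⟨_, x, hx, rfl⟩, hne, hy⟩ := exists_ne_eq_of_not_isLocalExtr hh' hcpt hextr
  exact ⟨x, hx, hy, fun hκx => hne (Subtype.ext (Quotient.sound hκx))⟩

end FibreModulo

section OrthogonalVariations

open Module

variable {F W : Type*} [AddCommGroup F] [Module ℝ F]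
  [NormedAddCommGroup W] [InnerProductSpace ℝ W]

/-- The space of linear maps `Y` with `⟪X f, Y f⟫ = 0` for all `f`: the infinitesimal variations
of `X` which do not change the quadratic form `‖X f‖ ^ 2`. -/
def orthogonalVariations (X : F →ₗ[ℝ] W) : Submodule ℝ (F →ₗ[ℝ] W) where
  carrier := {Y | ∀ f, ⟪X f, Y f⟫ = 0}
  add_mem' hY hZ f := by simp [inner_add_right, hY f, hZ f]
  zero_mem' f := by simp
  smul_mem' c Y hY f := by simp [inner_smul_right, hY f]

theorem inner_add_inner_eq_zero_of_mem_orthogonalVariations {X Y : F →ₗ[ℝ] W}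
    (hY : Y ∈ orthogonalVariations X) (f g : F) : ⟪X f, Y g⟫ + ⟪X g, Y f⟫ = 0 := by
  have h := hY (f + g)
  simp only [map_add, inner_add_left, inner_add_right, hY f, hY g] at h
  linarith

theorem mem_orthogonalVariations_of_basis {ι : Type*} (b : Basis ι ℝ F) {X Y : F →ₗ[ℝ] W}
    (h : ∀ i j, ⟪X (b i), Y (b j)⟫ + ⟪X (b j), Y (b i)⟫ = 0) : Y ∈ orthogonalVariations X := by
  let B : F →ₗ[ℝ] F →ₗ[ℝ] ℝ := (innerₗ W).compl₁₂ X Y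
  have hB : B + B.flip = 0 := LinearMap.ext_basis b b h
  intro f
  have hf : ⟪X f, Y f⟫ + ⟪X f, Y f⟫ = 0 := congr($hB f f)
  linarith

theorem exists_linearEquiv_prod_ker_of_surjective {X : F →ₗ[ℝ] W}
    (hX : Function.Surjective X) : ∃ e : F ≃ₗ[ℝ] W × X.ker, ∀ f, (e f).1 = X f := by
  obtain ⟨C, hC⟩ := X.ker.exists_isCompl
  exact ⟨X.equivProdOfSurjectiveOfIsCompl (Submodule.projectionOnto _ C hC)
    (LinearMap.range_eq_top.2 hX) (Submodule.range_projectionOnto hC)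
    (by rwa [Submodule.ker_projectionOnto]), fun f => rfl⟩

theorem finrank_orthogonalVariations_eq_of_surjective [FiniteDimensional ℝ F]
    {X X' : F →ₗ[ℝ] W} (hX : Function.Surjective X) (hX' : Function.Surjective X') :
    finrank ℝ (orthogonalVariations X) = finrank ℝ (orthogonalVariations X') := by
  obtain ⟨e, he⟩ := exists_linearEquiv_prod_ker_of_surjective hX
  obtain ⟨e', he'⟩ := exists_linearEquiv_prod_ker_of_surjective hX'
  have hker : finrank ℝ X.ker = finrank ℝ X'.ker := by
    have h := X.finrank_range_add_finrank_ker
    have h' := X'.finrank_range_add_finrank_ker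
    rw [LinearMap.range_eq_top.2 hX] at h
    rw [LinearMap.range_eq_top.2 hX'] at h'
    omega
  let g : F ≃ₗ[ℝ] F := (e.trans ((LinearEquiv.refl ℝ W).prodCongr
    (LinearEquiv.ofFinrankEq _ _ hker))).trans e'.symm
  have hg (f : F) : X' (g f) = X f := by simp [← he', ← he, g]
  have hmap : orthogonalVariations X =
      (orthogonalVariations X').map (g.symm.congrLeft W ℝ).toLinearMap := by
    ext Y
    rw [Submodule.mem_map_equiv]
    refine ⟨fun hY f => ?_, fun hY f => ?_⟩
    · simpa [← hg] using hY (g.symm f)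
    · simpa [← hg] using hY (g f)
  rw [hmap, LinearEquiv.finrank_map_eq]

section RankOneUpdate

variable {X : F →ₗ[ℝ] W} {a : W}

/-- The variations in `orthogonalVariations X` whose values on `ker X` are orthogonal to `a`. -/
def orthogonalVariationsAt (X : F →ₗ[ℝ] W) (a : W) : Submodule ℝ (F →ₗ[ℝ] W) where
  carrier := {Y | Y ∈ orthogonalVariations X ∧ ∀ f ∈ X.ker, ⟪a, Y f⟫ = 0}
  add_mem' hY hZ := ⟨add_mem hY.1 hZ.1, fun f hf => by
    simp [inner_add_right, hY.2 f hf, hZ.2 f hf]⟩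
  zero_mem' := ⟨zero_mem _, fun f _ => by simp⟩
  smul_mem' c Y hY := ⟨Submodule.smul_mem _ c hY.1, fun f hf => by
    simp [inner_smul_right, hY.2 f hf]⟩

theorem finrank_orthogonalVariationsAt_add [FiniteDimensional ℝ F] [FiniteDimensional ℝ W]
    (ha : a ∈ X.rangeᗮ) (ha₀ : a ≠ 0) :
    finrank ℝ (orthogonalVariationsAt X a) + finrank ℝ X.ker =
      finrank ℝ (orthogonalVariations X) := by
  let Λ : (F →ₗ[ℝ] W) →ₗ[ℝ] Dual ℝ X.ker :=
    (LinearMap.lcomp ℝ ℝ X.ker.subtype) ∘ₗ LinearMap.compRight ℝ (innerₛₗ ℝ a)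
  have hsurj : (Λ ∘ₗ (orthogonalVariations X).subtype).range = ⊤ := by
    refine LinearMap.range_eq_top.2 fun ψ => ?_
    obtain ⟨φ, rfl⟩ := LinearMap.exists_extend ψ
    refine ⟨⟨(‖a‖ ^ 2)⁻¹ • φ.smulRight a, fun f => ?_⟩, ?_⟩
    · simp [inner_smul_right, ha (X f) ⟨f, rfl⟩]
    · ext f
      simp [Λ, inner_smul_right]
      field_simp
  have hker : (Λ ∘ₗ (orthogonalVariations X).subtype).ker.map (orthogonalVariations X).subtype =
      orthogonalVariationsAt X a := by
    rw [LinearMap.ker_comp, Submodule.map_comap_subtype]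
    ext Y
    simp [Λ, LinearMap.ext_iff, orthogonalVariationsAt]
  have h := (Λ ∘ₗ (orthogonalVariations X).subtype).finrank_range_add_finrank_ker
  rw [hsurj, finrank_top, Subspace.dual_finrank_eq,
    ← Submodule.finrank_map_subtype_eq, hker] at h
  omega

variable {f₀ : F} {φ : Dual ℝ F} {Y : F →ₗ[ℝ] W}

/-- The map `Y ↦ Y ∘ P + φ ⊗ π (Y f₀)`, where `P f = f - φ f • f₀` and `π` is the orthogonal
projection onto `(range X)ᗮ`. If `f₀ ∈ ker X` and `φ f₀ = 1`, it turns variations of `X + φ ⊗ a`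
into variations of `X`. -/
noncomputable def rankOneTransfer [FiniteDimensional ℝ F] (X : F →ₗ[ℝ] W) (φ : Dual ℝ F) (f₀ : F) :
    (F →ₗ[ℝ] W) →ₗ[ℝ] (F →ₗ[ℝ] W) :=
  LinearMap.lcomp ℝ W (LinearMap.id - φ.smulRight f₀) +
    (LinearMap.smulRightₗ φ) ∘ₗ X.rangeᗮ.starProjection.toLinearMap ∘ₗ LinearMap.applyₗ f₀

theorem rankOneTransfer_apply [FiniteDimensional ℝ F] (f : F) : rankOneTransfer X φ f₀ Y f =
    Y (f - φ f • f₀) + φ f • X.rangeᗮ.starProjection (Y f₀) :=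
  rfl

theorem inner_add_inner_eq_zero_of_mem_orthogonalVariations_add_smulRight (hf₀ : X f₀ = 0)
    (hφ : φ f₀ = 1) (hY : Y ∈ orthogonalVariations (X + φ.smulRight a)) (f : F) :
    ⟪a, Y (f - φ f • f₀)⟫ + ⟪X f, Y f₀⟫ = 0 := by
  have h := inner_add_inner_eq_zero_of_mem_orthogonalVariations hY f₀ (f - φ f • f₀)
  simpa [hf₀, hφ] using h

theorem rankOneTransfer_mem [FiniteDimensional ℝ F] (ha : a ∈ X.rangeᗮ) (hf₀ : X f₀ = 0)
    (hφ : φ f₀ = 1) (hY : Y ∈ orthogonalVariations (X + φ.smulRight a)) :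
    rankOneTransfer X φ f₀ Y ∈ orthogonalVariationsAt X a := by
  refine ⟨fun f => ?_, fun f hf => ?_⟩
  · have hQ : ⟪X f, X.rangeᗮ.starProjection (Y f₀)⟫ = 0 :=
      (X.rangeᗮ.starProjection_apply_mem _) _ ⟨f, rfl⟩
    have hYf : ⟪X f, Y (f - φ f • f₀)⟫ = 0 := by simpa [hf₀, hφ] using hY (f - φ f • f₀)
    rw [rankOneTransfer_apply, inner_add_right, inner_smul_right, hYf, hQ, mul_zero, add_zero]
  · have hYf₀ : ⟪a, Y f₀⟫ = 0 := by simpa [hf₀, hφ] using hY f₀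
    have hYf : ⟪a, Y (f - φ f • f₀)⟫ = 0 := by
      simpa [LinearMap.mem_ker.1 hf] using
        inner_add_inner_eq_zero_of_mem_orthogonalVariations_add_smulRight hf₀ hφ hY f
    rw [rankOneTransfer_apply, inner_add_right, inner_smul_right, hYf,
      ← Submodule.inner_starProjection_left_eq_right,
      Submodule.starProjection_eq_self_iff.2 ha, hYf₀, mul_zero, add_zero]

theorem eq_zero_of_rankOneTransfer_eq_zero [FiniteDimensional ℝ F] (hf₀ : X f₀ = 0)
    (hφ : φ f₀ = 1) (hY : Y ∈ orthogonalVariations (X + φ.smulRight a))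
    (h : rankOneTransfer X φ f₀ Y = 0) : Y = 0 := by
  have hQ : X.rangeᗮ.starProjection (Y f₀) = 0 := by
    simpa [rankOneTransfer_apply, hφ] using congr($h f₀)
  have hYf (f : F) : Y (f - φ f • f₀) = 0 := by
    simpa [rankOneTransfer_apply, hQ] using congr($h f)
  have hYf₀ : Y f₀ ∈ X.rangeᗮ := by
    rintro _ ⟨f, rfl⟩
    simpa only [hYf, inner_zero_right, zero_add] using
      inner_add_inner_eq_zero_of_mem_orthogonalVariations_add_smulRight hf₀ hφ hY f
  rw [Submodule.starProjection_eq_self_iff.2 hYf₀] at hQ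
  ext f
  simpa [hQ] using hYf f

theorem finrank_orthogonalVariations_add_smulRight_le [FiniteDimensional ℝ F]
    [FiniteDimensional ℝ W] (ha : a ∈ X.rangeᗮ) (hf₀ : X f₀ = 0) (hφ : φ f₀ = 1) :
    finrank ℝ (orthogonalVariations (X + φ.smulRight a)) ≤
      finrank ℝ (orthogonalVariationsAt X a) :=
  LinearMap.finrank_le_finrank_of_injective
    (f := (rankOneTransfer X φ f₀).restrict fun _ hY => rankOneTransfer_mem ha hf₀ hφ hY)
    ((injective_iff_map_eq_zero _).2 fun Y hY => Subtype.ext <|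
      eq_zero_of_rankOneTransfer_eq_zero hf₀ hφ Y.2 (congrArg Subtype.val hY))

end RankOneUpdate

theorem exists_finrank_orthogonalVariations_add_le [FiniteDimensional ℝ F]
    [FiniteDimensional ℝ W] {X : F →ₗ[ℝ] W}
    (hX : ¬ Function.Surjective X) (hker : X.ker ≠ ⊥) :
    ∃ X₁ : F →ₗ[ℝ] W, finrank ℝ (orthogonalVariations X₁) + finrank ℝ X.ker ≤
      finrank ℝ (orthogonalVariations X) := by
  obtain ⟨f₀, hf₀, hne⟩ := Submodule.exists_mem_ne_zero_of_ne_bot hker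
  obtain ⟨φ, hφ⟩ := Module.Projective.exists_dual_eq_one ℝ hne
  obtain ⟨a, ha, ha₀⟩ := Submodule.exists_mem_ne_zero_of_ne_bot
    (mt Submodule.orthogonal_eq_bot_iff.1 (mt LinearMap.range_eq_top.1 hX))
  exact ⟨X + φ.smulRight a, (finrank_orthogonalVariationsAt_add ha ha₀).symm ▸
    Nat.add_le_add_right (finrank_orthogonalVariations_add_smulRight_le ha hf₀ hφ) _⟩

end OrthogonalVariations

section InfinitesimalCongruences

open Module

variable {V H : Type*} [NormedAddCommGroup H] [InnerProductSpace ℝ H]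

/-- The infinitesimal motions of the point configuration `q` that preserve all distances between
its points as well as the components of the points along `U`, up to a common translation. -/
def infinitesimalCongruences (U : Submodule ℝ H) (q : V → H) : Submodule ℝ (V → H) where
  carrier := {w | ∀ u v, ⟪q u - q v, w u - w v⟫ = 0 ∧ w u - w v ∈ Uᗮ}
  add_mem' {w z} hw hz u v := by
    have h : (w + z) u - (w + z) v = (w u - w v) + (z u - z v) := add_sub_add_comm _ _ _ _
    rw [h, inner_add_right, (hw u v).1, (hz u v).1, add_zero]
    exact ⟨rfl, add_mem (hw u v).2 (hz u v).2⟩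
  zero_mem' u v := by simp
  smul_mem' c w hw u v := by
    have h : (c • w) u - (c • w) v = c • (w u - w v) := (smul_sub _ _ _).symm
    rw [h, inner_smul_right, (hw u v).1, mul_zero]
    exact ⟨rfl, Submodule.smul_mem _ c (hw u v).2⟩

theorem mem_infinitesimalCongruences {U : Submodule ℝ H} {q w : V → H} :
    w ∈ infinitesimalCongruences U q ↔
      ∀ u v, ⟪q u - q v, w u - w v⟫ = 0 ∧ w u - w v ∈ Uᗮ :=
  Iff.rfl

/-- The unit vector of `{v // v ≠ v₀} → ℝ` at `v`, and `0` for `v = v₀`. -/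
noncomputable def relativeUnit (v₀ v : V) : {v : V // v ≠ v₀} → ℝ :=
  open Classical in fun u => Pi.single (M := fun _ => ℝ) v 1 u.1

theorem relativeUnit_self (v₀ : V) : relativeUnit v₀ v₀ = 0 := by
  classical
  exact funext fun u => Pi.single_eq_of_ne u.2 1

theorem relativeUnit_coe [DecidableEq V] {v₀ : V} (v : {v : V // v ≠ v₀}) :
    relativeUnit v₀ v = Pi.single v 1 := by
  ext u
  simp [relativeUnit, Pi.single_apply, Subtype.ext_iff]

/-- The linear extension of `v ↦ x v - x v₀`, with `v` identified with `relativeUnit v₀ v`. -/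
noncomputable def relativePosition [Fintype V] {M : Type*} [AddCommGroup M] [Module ℝ M]
    (v₀ : V) (x : V → M) : ({v : V // v ≠ v₀} → ℝ) →ₗ[ℝ] M :=
  open Classical in Fintype.linearCombination ℝ fun v => x v.1 - x v₀

theorem relativePosition_relativeUnit [Fintype V] {M : Type*} [AddCommGroup M] [Module ℝ M]
    (v₀ : V) (x : V → M) (v : V) :
    relativePosition v₀ x (relativeUnit v₀ v) = x v - x v₀ := by
  classical
  rcases eq_or_ne v v₀ with rfl | hv
  · rw [relativeUnit_self, map_zero, sub_self]
  · rw [relativeUnit_coe ⟨v, hv⟩, relativePosition, Fintype.linearCombination_apply_single,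
      one_smul]

theorem relativePosition_comp_relativeUnit [Fintype V] {M : Type*} [AddCommGroup M] [Module ℝ M]
    (v₀ : V) (X : ({v : V // v ≠ v₀} → ℝ) →ₗ[ℝ] M) :
    relativePosition v₀ (fun v => X (relativeUnit v₀ v)) = X := by
  classical
  refine (Pi.basisFun ℝ _).ext fun v => ?_
  rw [Pi.basisFun_apply, ← relativeUnit_coe, relativePosition_relativeUnit, relativeUnit_self,
    map_zero, sub_zero]

/-- The motion with velocity `t` at `v₀` and velocity `Y v` relative to `v₀` at `v`. -/
noncomputable def relativeMotion (U : Submodule ℝ H) (v₀ : V) :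
    (H × (({v : V // v ≠ v₀} → ℝ) →ₗ[ℝ] Uᗮ)) →ₗ[ℝ] V → H :=
  LinearMap.pi fun v => LinearMap.fst ℝ _ _ +
    Uᗮ.subtype ∘ₗ LinearMap.applyₗ (relativeUnit v₀ v) ∘ₗ LinearMap.snd ℝ _ _

theorem relativeMotion_apply (U : Submodule ℝ H) (v₀ : V) (t : H)
    (Y : ({v : V // v ≠ v₀} → ℝ) →ₗ[ℝ] Uᗮ) (v : V) :
    relativeMotion U v₀ (t, Y) v = t + Y (relativeUnit v₀ v) :=
  rfl

theorem relativeMotion_sub (U : Submodule ℝ H) (v₀ : V) (t : H)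
    (Y : ({v : V // v ≠ v₀} → ℝ) →ₗ[ℝ] Uᗮ) (u v : V) :
    relativeMotion U v₀ (t, Y) u - relativeMotion U v₀ (t, Y) v =
      Y (relativeUnit v₀ u - relativeUnit v₀ v) := by
  simp [relativeMotion_apply]

variable (U : Submodule ℝ H) (q : V → H) (v₀ : V)

theorem relativeMotion_injective [Finite V] : Function.Injective (relativeMotion U v₀) := by
  have := Fintype.ofFinite V
  refine (injective_iff_map_eq_zero _).2 fun ⟨t, Y⟩ h => ?_
  obtain rfl : t = 0 := by simpa [relativeMotion_apply, relativeUnit_self] using congr($h v₀)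
  have hY (v : V) : Y (relativeUnit v₀ v) = 0 := by
    simpa [relativeMotion_apply] using congr($h v)
  have hY₀ : Y = 0 := by
    rw [← relativePosition_comp_relativeUnit v₀ Y, funext hY]
    exact LinearMap.ext fun f => by simp [relativePosition, Fintype.linearCombination_apply]
  rw [hY₀, Prod.mk_zero_zero]

theorem exists_relativeMotion_eq [Finite V] {w : V → H} (hw : ∀ u v, w u - w v ∈ Uᗮ) :
    ∃ tY, relativeMotion U v₀ tY = w := by
  have := Fintype.ofFinite V
  refine ⟨(w v₀, relativePosition v₀ fun v => ⟨w v - w v₀, hw v v₀⟩), funext fun v => ?_⟩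
  simp [relativeMotion_apply, relativePosition_relativeUnit]

variable [Fintype V] [FiniteDimensional ℝ H]

theorem inner_relativePosition_relativeUnit_sub (u v : V) (y : Uᗮ) :
    ⟪relativePosition v₀ (fun v => Uᗮ.orthogonalProjectionOnto (q v))
      (relativeUnit v₀ u - relativeUnit v₀ v), y⟫ = ⟪q u - q v, (y : H)⟫ := by
  simp only [map_sub, relativePosition_relativeUnit, sub_sub_sub_cancel_right]
  rw [← map_sub, Submodule.inner_orthogonalProjectionOnto_eq_of_mem_right]

theorem relativeMotion_mem_infinitesimalCongruences {t : H}
    {Y : ({v : V // v ≠ v₀} → ℝ) →ₗ[ℝ] Uᗮ} :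
    relativeMotion U v₀ (t, Y) ∈ infinitesimalCongruences U q ↔ Y ∈ orthogonalVariations
      (relativePosition v₀ fun v => Uᗮ.orthogonalProjectionOnto (q v)) := by
  classical
  simp only [mem_infinitesimalCongruences, relativeMotion_sub, SetLike.coe_mem, and_true,
    ← inner_relativePosition_relativeUnit_sub U q v₀]
  refine ⟨fun h => ?_, fun hY u v => hY _⟩
  have h₀ (u : V) := by simpa only [relativeUnit_self, sub_zero] using h u v₀
  refine mem_orthogonalVariations_of_basis (Pi.basisFun ℝ _) fun u v => ?_
  rw [Pi.basisFun_apply, Pi.basisFun_apply, ← relativeUnit_coe, ← relativeUnit_coe]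
  have huv := h u v
  simp only [map_sub, inner_sub_left, inner_sub_right, h₀] at huv
  linarith

theorem finrank_infinitesimalCongruences : finrank ℝ (infinitesimalCongruences U q) =
    finrank ℝ H + finrank ℝ (orthogonalVariations
      (relativePosition v₀ fun v => Uᗮ.orthogonalProjectionOnto (q v))) := by
  set K := orthogonalVariations (relativePosition v₀ fun v => Uᗮ.orthogonalProjectionOnto (q v))
  let Φ : H × K →ₗ[ℝ] V → H := relativeMotion U v₀ ∘ₗ LinearMap.id.prodMap K.subtype
  have hrange : infinitesimalCongruences U q = Φ.range := by
    ext w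
    refine ⟨fun hw => ?_, ?_⟩
    · obtain ⟨⟨t, Y⟩, rfl⟩ := exists_relativeMotion_eq U v₀ fun u v => (hw u v).2
      exact ⟨(t, ⟨Y, (relativeMotion_mem_infinitesimalCongruences U q v₀).1 hw⟩), rfl⟩
    · rintro ⟨⟨t, Y⟩, rfl⟩
      exact (relativeMotion_mem_infinitesimalCongruences U q v₀).2 Y.2
  have hinj : Function.Injective Φ := (relativeMotion_injective U v₀).comp
    (Function.injective_id.prodMap K.subtype_injective)
  rw [hrange, LinearMap.finrank_range_of_inj hinj, finrank_prod]

variable {U q}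

/-- Surjectivity of the relative position map means that `q` affinely spans `H` modulo `U`. -/
theorem exists_finrank_infinitesimalCongruences_add_two_le
    (hV : finrank ℝ Uᗮ + 2 ≤ Fintype.card V) (hq : ¬ Function.Surjective
      (relativePosition v₀ fun v => Uᗮ.orthogonalProjectionOnto (q v))) :
    ∃ q₁ : V → H, finrank ℝ (infinitesimalCongruences U q₁) + 2 ≤
      finrank ℝ (infinitesimalCongruences U q) := by
  classical
  set X := relativePosition v₀ fun v => Uᗮ.orthogonalProjectionOnto (q v)
  have hker : 2 ≤ finrank ℝ X.ker := by
    have hrange := Submodule.finrank_lt (mt LinearMap.range_eq_top.1 hq)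
    have hrank := X.finrank_range_add_finrank_ker
    rw [finrank_fintype_fun_eq_card, Fintype.card_subtype_compl, Fintype.card_subtype_eq]
      at hrank
    omega
  obtain ⟨X₁, hX₁⟩ := exists_finrank_orthogonalVariations_add_le hq fun h => by
    rw [h, finrank_bot] at hker
    omega
  refine ⟨fun v => X₁ (relativeUnit v₀ v), ?_⟩
  have hX : (relativePosition v₀ fun v =>
      Uᗮ.orthogonalProjectionOnto (X₁ (relativeUnit v₀ v) : H)) = X₁ := by
    simp only [Submodule.orthogonalProjectionOnto_mem_subspace_eq_self,
      relativePosition_comp_relativeUnit]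
  have hdim : finrank ℝ (infinitesimalCongruences U q) =
      finrank ℝ H + finrank ℝ (orthogonalVariations X) := finrank_infinitesimalCongruences U q v₀
  rw [finrank_infinitesimalCongruences U _ v₀, hX, hdim]
  omega

theorem finrank_infinitesimalCongruences_eq_or_add_two_le {p : V → H}
    (hp : ∀ q : V → H, finrank ℝ (infinitesimalCongruences U p) ≤
      finrank ℝ (infinitesimalCongruences U q))
    (hV : finrank ℝ Uᗮ + 2 ≤ Fintype.card V) (q : V → H) :
    finrank ℝ (infinitesimalCongruences U q) = finrank ℝ (infinitesimalCongruences U p) ∨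
      finrank ℝ (infinitesimalCongruences U p) + 2 ≤
        finrank ℝ (infinitesimalCongruences U q) := by
  obtain ⟨v₀⟩ : Nonempty V := Fintype.card_pos_iff.1 (by omega)
  refine or_iff_not_imp_right.2 fun hlt => ?_
  have hsurj {x : V → H} (hx : finrank ℝ (infinitesimalCongruences U x) <
      finrank ℝ (infinitesimalCongruences U p) + 2) : Function.Surjective
        (relativePosition v₀ fun v => Uᗮ.orthogonalProjectionOnto (x v)) := by
    by_contra hx'
    obtain ⟨q₁, hq₁⟩ := exists_finrank_infinitesimalCongruences_add_two_le v₀ hV hx'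
    have := hp q₁
    omega
  rw [finrank_infinitesimalCongruences U q v₀, finrank_infinitesimalCongruences U p v₀,
    finrank_orthogonalVariations_eq_of_surjective (hsurj (not_le.1 hlt))
      (hsurj (x := p) (by omega))]

end InfinitesimalCongruences

section GramMatrix

variable {ι H : Type*} [NormedAddCommGroup H] [InnerProductSpace ℝ H] [FiniteDimensional ℝ H]

theorem exists_linearIsometry_apply_eq_of_inner_eq {x y : ι → H}
    (h : ∀ i j, ⟪x i, x j⟫ = ⟪y i, y j⟫) : ∃ R : H →ₗᵢ[ℝ] H, ∀ i, R (x i) = y i := by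
  let X := Finsupp.linearCombination ℝ x
  let Y := Finsupp.linearCombination ℝ y
  have hnorm (c : ι →₀ ℝ) : ‖Y c‖ = ‖X c‖ := by
    rw [← sq_eq_sq₀ (norm_nonneg _) (norm_nonneg _), ← real_inner_self_eq_norm_sq,
      ← real_inner_self_eq_norm_sq]
    simp only [X, Y, Finsupp.linearCombination_apply, Finsupp.sum, sum_inner, inner_sum,
      real_inner_smul_left, real_inner_smul_right, h]
  obtain ⟨S, hS⟩ := X.rangeRestrict.exists_rightInverse_of_surjective X.range_rangeRestrict
  have hXS (z : X.range) : X (S z) = z := congrArg Subtype.val (LinearMap.congr_fun hS z)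
  let R : X.range →ₗᵢ[ℝ] H := ⟨Y ∘ₗ S, fun z => by
    rw [LinearMap.comp_apply, hnorm, hXS, Submodule.coe_norm]⟩
  have hR (c : ι →₀ ℝ) : R (X.rangeRestrict c) = Y c := by
    change Y (S (X.rangeRestrict c)) = Y c
    rw [← sub_eq_zero, ← map_sub, ← norm_eq_zero, hnorm, map_sub, hXS]
    exact norm_eq_zero.2 (sub_self _)
  refine ⟨R.extend, fun i => ?_⟩
  simpa [X, Y] using (R.extend_apply (X.rangeRestrict (.single i 1))).trans (hR (.single i 1))

end GramMatrix

/-- An isometry of the space that commutes with the translations by the vectors `L γ`. -/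
structure IsPeriodicIsometry {Γ : Type*} [AddCommGroup Γ] {d : ℕ}
    (L : Γ →+ EuclideanSpace ℝ (Fin d)) (φ : EuclideanSpace ℝ (Fin d) → EuclideanSpace ℝ (Fin d)) :
    Prop where
  isometry : Isometry φ
  map_add : ∀ x γ, φ (x + L γ) = φ x + L γ

theorem isPeriodicIsometry_add_const {Γ : Type*} [AddCommGroup Γ] {d : ℕ}
    (L : Γ →+ EuclideanSpace ℝ (Fin d)) (t : EuclideanSpace ℝ (Fin d)) :
    IsPeriodicIsometry L (· + t) :=
  ⟨isometry_add_right t, fun _ _ => add_right_comm _ _ _⟩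

namespace LabeledGraph

section Congruence

variable {V E Γ : Type*} [AddCommGroup Γ] {d : ℕ} (G : LabeledGraph V E Γ)
  {L : Γ →+ EuclideanSpace ℝ (Fin d)} {p q : V → EuclideanSpace ℝ (Fin d)}

theorem lengthSq_comp_of_isPeriodicIsometry
    {φ : EuclideanSpace ℝ (Fin d) → EuclideanSpace ℝ (Fin d)} (hφ : IsPeriodicIsometry L φ)
    (p : V → EuclideanSpace ℝ (Fin d)) : G.lengthSq L (φ ∘ p) = G.lengthSq L p := by
  ext e
  simp only [lengthSq, Function.comp_apply, ← hφ.map_add, ← dist_eq_norm, hφ.isometry.dist_eq]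

theorem infinitesimalCongruences_le_ker_rigidityMap (p : V → EuclideanSpace ℝ (Fin d)) :
    infinitesimalCongruences (.span ℝ (range L)) p ≤ (G.rigidityMap L p).ker := by
  intro w hw
  refine (G.mem_ker_rigidityMap L).2 fun e => ?_
  obtain ⟨hinner, horth⟩ := mem_infinitesimalCongruences.1 hw (G.src e) (G.tgt e)
  rw [← sub_sub, inner_sub_left, hinner, horth _ (Submodule.subset_span (mem_range_self _)),
    sub_zero]

variable (V) in
/-- The complete graph with labels in a finite set `s`. When `s` contains `0` and `L(s)` spans
`L(Γ)`, its finitely many edge lengths determine those of all of `K(V, Γ)`. -/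
def completeOn (s : Finset Γ) : LabeledGraph V (V × V × s) Γ where
  src e := e.1
  tgt e := e.2.1
  label e := e.2.2

theorem lengthSq_completeOn_eq_of_lengthSq_complete_eq {s : Finset Γ}
    (h : (complete V Γ).lengthSq L p = (complete V Γ).lengthSq L q) :
    (completeOn V s).lengthSq L p = (completeOn V s).lengthSq L q :=
  funext fun ⟨u, v, γ⟩ => congrFun h (u, v, γ)

theorem exists_finset_span_image_eq (L : Γ →+ EuclideanSpace ℝ (Fin d)) :
    ∃ s : Finset Γ, 0 ∈ s ∧ Submodule.span ℝ (L '' s) = .span ℝ (range L) := by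
  classical
  obtain ⟨t, ht, hspan⟩ := Submodule.fg_span_iff_fg_span_finset_subset (range L) |>.1
    (IsNoetherian.noetherian (Submodule.span ℝ (range L)))
  rw [← image_univ] at ht
  obtain ⟨s, -, rfl⟩ := Finset.subset_set_image_iff.1 ht
  refine ⟨insert 0 s, Finset.mem_insert_self _ _, ?_⟩
  rw [Finset.coe_insert, image_insert_eq, map_zero, Submodule.span_insert_zero, hspan,
    Finset.coe_image]

variable {s : Finset Γ} (h0 : 0 ∈ s) (hs : Submodule.span ℝ (L '' s) = .span ℝ (range L))

include h0

theorem norm_sub_eq_of_lengthSq_completeOn_eq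
    (h : (completeOn V s).lengthSq L p = (completeOn V s).lengthSq L q) (u v : V) :
    ‖p u - p v‖ = ‖q u - q v‖ := by
  rw [← sq_eq_sq₀ (norm_nonneg _) (norm_nonneg _)]
  simpa only [lengthSq, completeOn, map_zero, add_zero] using congrFun h (u, v, ⟨0, h0⟩)

theorem inner_label_eq_of_lengthSq_completeOn_eq
    (h : (completeOn V s).lengthSq L p = (completeOn V s).lengthSq L q) (u v : V) (γ : s) :
    ⟪p u - p v, L γ⟫ = ⟪q u - q v, L γ⟫ := by
  have hγ : ‖p u - (p v + L γ)‖ ^ 2 = ‖q u - (q v + L γ)‖ ^ 2 := congrFun h (u, v, γ)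
  rw [← sub_sub, ← sub_sub, norm_sub_sq_real (p u - p v), norm_sub_sq_real (q u - q v),
    norm_sub_eq_of_lengthSq_completeOn_eq h0 h] at hγ
  linarith

include hs

theorem exists_isPeriodicIsometry_of_lengthSq_completeOn_eq
    (h : (completeOn V s).lengthSq L p = (completeOn V s).lengthSq L q) :
    ∃ φ, IsPeriodicIsometry L φ ∧ φ ∘ p = q := by
  rcases isEmpty_or_nonempty V with _ | ⟨⟨v₀⟩⟩
  · exact ⟨_, isPeriodicIsometry_add_const L 0, Subsingleton.elim _ _⟩
  obtain ⟨R, hR⟩ := exists_linearIsometry_apply_eq_of_inner_eq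
    (x := Sum.elim (fun v => p v - p v₀) fun γ : s => L γ)
    (y := Sum.elim (fun v => q v - q v₀) fun γ : s => L γ) (by
      have hlabel := inner_label_eq_of_lengthSq_completeOn_eq h0 h
      rintro (u | γ) (v | γ') <;> simp only [Sum.elim_inl, Sum.elim_inr]
      · simp only [real_inner_eq_norm_mul_self_add_norm_mul_self_sub_norm_sub_mul_self_div_two,
          sub_sub_sub_cancel_right, norm_sub_eq_of_lengthSq_completeOn_eq h0 h]
      · exact hlabel u v₀ γ'
      · rw [real_inner_comm, hlabel, real_inner_comm])
  have hRL (γ : Γ) : R (L γ) = L γ := by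
    refine LinearMap.eqOn_span (f := R.toLinearMap) (g := .id) ?_
      (hs ▸ Submodule.subset_span (mem_range_self γ) : L γ ∈ Submodule.span ℝ (L '' s))
    rintro _ ⟨γ, hγ, rfl⟩
    exact hR (.inr ⟨γ, hγ⟩)
  refine ⟨fun x => R (x - p v₀) + q v₀, ⟨fun x y => by simp, fun x γ => ?_⟩, ?_⟩
  · rw [add_sub_right_comm, R.map_add, hRL, add_right_comm]
  · ext1 v
    exact eq_sub_iff_add_eq.1 (hR (.inl v))

theorem lengthSq_eq_of_lengthSq_completeOn_eq
    (h : (completeOn V s).lengthSq L p = (completeOn V s).lengthSq L q) :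
    G.lengthSq L p = G.lengthSq L q := by
  obtain ⟨φ, hφ, rfl⟩ := exists_isPeriodicIsometry_of_lengthSq_completeOn_eq h0 hs h
  exact (G.lengthSq_comp_of_isPeriodicIsometry hφ p).symm

theorem isOpenMap_mk_ker_lengthSq_completeOn :
    IsOpenMap (Quotient.mk (Setoid.ker ((completeOn V s).lengthSq L))) := by
  intro N hN
  have hsat : Quotient.mk (Setoid.ker ((completeOn V s).lengthSq L)) ⁻¹' (Quotient.mk _ '' N) =
      ⋃ (φ) (_ : IsPeriodicIsometry L φ), (fun q => φ ∘ q) ⁻¹' N := by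
    ext q
    simp only [mem_iUnion, exists_prop]
    constructor
    · rintro ⟨p, hp, hpq⟩
      obtain ⟨φ, hφ, rfl⟩ := exists_isPeriodicIsometry_of_lengthSq_completeOn_eq h0 hs
        (Quotient.exact hpq).symm
      exact ⟨φ, hφ, hp⟩
    · rintro ⟨φ, hφ, hq⟩
      exact ⟨φ ∘ q, hq, Quotient.sound ((completeOn V s).lengthSq_comp_of_isPeriodicIsometry hφ q)⟩
  rw [← isQuotientMap_quotient_mk'.isOpen_preimage]
  refine hsat ▸ isOpen_iUnion fun φ => isOpen_iUnion fun hφ => hN.preimage ?_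
  exact continuous_pi fun v => hφ.isometry.continuous.comp (continuous_apply v)

theorem ker_rigidityMap_completeOn (p : V → EuclideanSpace ℝ (Fin d)) :
    ((completeOn V s).rigidityMap L p).ker =
      infinitesimalCongruences (.span ℝ (range L)) p := by
  refine le_antisymm (fun w hw => ?_) (infinitesimalCongruences_le_ker_rigidityMap _ p)
  have hw' (u v : V) (γ : s) : ⟪(p u - p v) - L γ, w u - w v⟫ = 0 := by
    rw [sub_sub]
    exact ((completeOn V s).mem_ker_rigidityMap L).1 hw (u, v, γ)
  have hinner (u v : V) : ⟪p u - p v, w u - w v⟫ = 0 := by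
    simpa only [map_zero, sub_zero] using hw' u v ⟨0, h0⟩
  refine mem_infinitesimalCongruences.2 fun u v => ⟨hinner u v, ?_⟩
  rw [← hs, ← Submodule.span_singleton_le_iff_mem, ← Submodule.isOrtho_iff_le,
    Submodule.isOrtho_comm, Submodule.isOrtho_span]
  rintro _ ⟨γ, hγ, rfl⟩ _ rfl
  simpa only [inner_sub_left, hinner, zero_sub, neg_eq_zero] using hw' u v ⟨γ, hγ⟩

end Congruence

section GlobalRigidity

variable {V E Γ : Type*} [AddCommGroup Γ] {d : ℕ} {G : LabeledGraph V E Γ}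
  {L : Γ →+ EuclideanSpace ℝ (Fin d)} {p q : V → EuclideanSpace ℝ (Fin d)}

theorem finrank_infinitesimalCongruences_le_of_generic [Finite V] (hp : IsGenericRealization L p)
    (q : V → EuclideanSpace ℝ (Fin d)) :
    Module.finrank ℝ (infinitesimalCongruences (.span ℝ (range L)) p) ≤
      Module.finrank ℝ (infinitesimalCongruences (.span ℝ (range L)) q) := by
  obtain ⟨s, h0, hs⟩ := exists_finset_span_image_eq L
  rw [← ker_rigidityMap_completeOn h0 hs, ← ker_rigidityMap_completeOn h0 hs]
  exact (completeOn V s).finrank_ker_rigidityMap_le_of_generic L hp q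

theorem IsPeriodicallyGloballyRigid.ker_rigidityMap_le [Finite V] [Finite E]
    (hG : G.IsPeriodicallyGloballyRigid L p) (hp : IsGenericRealization L p) :
    (G.rigidityMap L p).ker ≤ infinitesimalCongruences (.span ℝ (range L)) p := by
  obtain ⟨s, h0, hs⟩ := exists_finset_span_image_eq L
  have := Fintype.ofFinite V
  have := Fintype.ofFinite E
  let κ := (completeOn V s).lengthSq L
  have hκ : ContDiff ℝ 1 κ := (completeOn V s).contDiff_lengthSq L
  rw [← ker_rigidityMap_completeOn h0 hs, ← fderiv_lengthSq, ← fderiv_lengthSq]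
  by_contra hnot
  obtain ⟨w, hw, hκw⟩ := SetLike.not_le_iff_exists.1 hnot
  obtain ⟨l, hl⟩ := SeparatingDual.exists_ne_zero (R := ℝ) hκw
  obtain ⟨σ, -, hσ⟩ := exists_continuousAt_section (x₀ := p) (G.contDiff_lengthSq L)
    (l.contDiff.comp hκ) (.of_forall fun q => by
      rw [fderiv_lengthSq, fderiv_lengthSq]
      exact G.finrank_ker_rigidityMap_le_of_generic L hp q) hw
    (by rwa [fderiv_comp _ l.differentiableAt (hκ.differentiable one_ne_zero p), l.fderiv])
  obtain ⟨t, ⟨-, ht, hlt⟩, hne⟩ := ((hσ.filter_mono nhdsWithin_le_nhds).and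
    (eventually_mem_nhdsWithin (a := (l ∘ κ) p) (s := {(l ∘ κ) p}ᶜ))).exists
  refine hne (hlt.symm.trans (congrArg l ?_))
  exact lengthSq_completeOn_eq_of_lengthSq_complete_eq (hG _ ht.symm).symm

theorem isPeriodicallyRigid_of_ker_rigidityMap_le [Finite V] [Finite E]
    (hp : IsGenericRealization L p)
    (hker : (G.rigidityMap L p).ker ≤ infinitesimalCongruences (.span ℝ (range L)) p) :
    G.IsPeriodicallyRigid L p := by
  obtain ⟨s, h0, hs⟩ := exists_finset_span_image_eq L
  have := Fintype.ofFinite V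
  have := Fintype.ofFinite E
  obtain ⟨N, hN, hNκ⟩ := exists_nhds_eq_of_ker_le (x₀ := p) (G.contDiff_lengthSq L)
    (((completeOn V s).contDiff_lengthSq L).differentiable one_ne_zero)
    (by rwa [fderiv_lengthSq, fderiv_lengthSq, ker_rigidityMap_completeOn h0 hs])
    (.of_forall fun q => by
      rw [fderiv_lengthSq, fderiv_lengthSq, ker_rigidityMap_completeOn h0 hs]
      exact G.infinitesimalCongruences_le_ker_rigidityMap q)
    (.of_forall fun q => by
      rw [fderiv_lengthSq, fderiv_lengthSq]
      exact (completeOn V s).finrank_ker_rigidityMap_le_of_generic L hp q)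
  obtain ⟨N', hN', hopen, hpN'⟩ := mem_nhds_iff.1 hN
  exact ⟨N', hopen, hpN', fun q hq hpq => lengthSq_eq_of_lengthSq_completeOn_eq _ h0 hs
    (hNκ p (mem_of_mem_nhds hN) q (hN' hq) hpq)⟩

variable (G) in
/-- Connectedness of the underlying undirected graph. -/
def IsConnected : Prop :=
  ∀ u v, Relation.EqvGen (fun a b => ∃ e, G.src e = a ∧ G.tgt e = b) u v

theorem IsPeriodicallyGloballyRigid.isConnected (hG : G.IsPeriodicallyGloballyRigid L p)
    (hp : Function.Injective p) : G.IsConnected := by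
  classical
  intro u v
  set r := Relation.EqvGen fun a b => ∃ e, G.src e = a ∧ G.tgt e = b
  have hedge (e : E) : r u (G.src e) ↔ r u (G.tgt e) :=
    ⟨fun h => h.trans _ _ _ (.rel _ _ ⟨e, rfl, rfl⟩),
      fun h => h.trans _ _ _ (.symm _ _ (.rel _ _ ⟨e, rfl, rfl⟩))⟩
  by_contra hv
  -- Translate the vertices outside the component of `u` so that `v` collides with `u`.
  let q : V → EuclideanSpace ℝ (Fin d) := fun a => if r u a then p a else p a + (p u - p v)
  have hq : G.lengthSq L p = G.lengthSq L q := by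
    ext e
    by_cases h : r u (G.src e)
    · simp only [lengthSq, q, if_pos h, if_pos ((hedge e).1 h)]
    · simp only [lengthSq, q, if_neg h, if_neg (mt (hedge e).2 h)]
      rw [add_right_comm (p (G.tgt e)), add_sub_add_right_eq_sub]
  have hqu : q u = p u := if_pos (.refl u)
  have hqv : q v = p u := (if_neg hv).trans (add_sub_cancel _ _)
  have huv : p u = p v := by
    simpa [lengthSq, complete, hqu, hqv, sub_eq_zero] using congrFun (hG q hq) (u, v, 0)
  exact hv (hp huv ▸ .refl u)

theorem IsConnected.exists_norm_sub_le (hG : G.IsConnected) (b : E → ℝ) (u v : V) :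
    ∃ C, ∀ q, (∀ e, G.lengthSq L q e ≤ b e) → ‖q u - q v‖ ≤ C := by
  induction hG u v with
  | rel _ _ h =>
    obtain ⟨e, rfl, rfl⟩ := h
    refine ⟨√(b e) + ‖L (G.label e)‖, fun q hq => ?_⟩
    have he : ‖q (G.src e) - q (G.tgt e) - L (G.label e)‖ ≤ √(b e) :=
      Real.le_sqrt_of_sq_le ((sub_sub (q (G.src e)) _ _).symm ▸ hq e)
    linarith [norm_sub_norm_le (q (G.src e) - q (G.tgt e)) (L (G.label e))]
  | refl => exact ⟨0, fun q _ => by simp⟩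
  | symm _ _ _ ih => exact ih.imp fun C hC q hq => norm_sub_rev (q _) (q _) ▸ hC q hq
  | trans _ _ _ _ _ ih₁ ih₂ =>
    obtain ⟨C₁, hC₁⟩ := ih₁
    obtain ⟨C₂, hC₂⟩ := ih₂
    exact ⟨C₁ + C₂, fun q hq => (norm_sub_le_norm_sub_add_norm_sub _ _ _).trans
      (add_le_add (hC₁ q hq) (hC₂ q hq))⟩

theorem IsConnected.exists_isCompact [Nonempty V] (hG : G.IsConnected)
    (L : Γ →+ EuclideanSpace ℝ (Fin d)) (b : E → ℝ) :
    ∃ K : Set (V → EuclideanSpace ℝ (Fin d)), IsCompact K ∧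
      ∀ q, (∀ e, G.lengthSq L q e ≤ b e) → ∃ φ, IsPeriodicIsometry L φ ∧ φ ∘ q ∈ K := by
  let v₀ := Classical.arbitrary V
  choose C hC using fun v => hG.exists_norm_sub_le (L := L) b v v₀
  refine ⟨univ.pi fun v => Metric.closedBall 0 (C v),
    isCompact_univ_pi fun v => isCompact_closedBall _ _,
    fun q hq => ⟨_, isPeriodicIsometry_add_const L (-q v₀), fun v _ => ?_⟩⟩
  rw [mem_closedBall_zero_iff, Function.comp_apply, ← sub_eq_add_neg]
  exact hC v q hq

theorem lengthSq_le_of_deleteEdge {e : E}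
    (h : (G.deleteEdge e).lengthSq L p ≤ (G.deleteEdge e).lengthSq L q)
    (he : G.lengthSq L p e ≤ G.lengthSq L q e) : G.lengthSq L p ≤ G.lengthSq L q := by
  intro e'
  rcases eq_or_ne e' e with rfl | hne
  · exact he
  · exact h ⟨e', hne⟩

theorem lengthSq_eq_of_deleteEdge {e : E}
    (h : (G.deleteEdge e).lengthSq L p = (G.deleteEdge e).lengthSq L q)
    (he : G.lengthSq L p e = G.lengthSq L q e) : G.lengthSq L p = G.lengthSq L q :=
  (lengthSq_le_of_deleteEdge h.le he.le).antisymm (lengthSq_le_of_deleteEdge h.ge he.ge)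

theorem mem_ker_rigidityMap_of_deleteEdge {e : E} {w : V → EuclideanSpace ℝ (Fin d)}
    (h : w ∈ ((G.deleteEdge e).rigidityMap L p).ker) (he : G.rigidityMap L p w e = 0) :
    w ∈ (G.rigidityMap L p).ker := by
  refine LinearMap.mem_ker.2 (funext fun e' => ?_)
  rcases eq_or_ne e' e with rfl | hne
  · exact he
  · exact congrFun (LinearMap.mem_ker.1 h) ⟨e', hne⟩

theorem finrank_ker_rigidityMap_deleteEdge_le [Finite V] (e : E) :
    Module.finrank ℝ ((G.deleteEdge e).rigidityMap L p).ker ≤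
      Module.finrank ℝ (G.rigidityMap L p).ker + 1 := by
  let S := ((G.deleteEdge e).rigidityMap L p).ker
  let a : S →ₗ[ℝ] ℝ := LinearMap.proj e ∘ₗ (G.rigidityMap L p).toLinearMap ∘ₗ S.subtype
  have hrange : Module.finrank ℝ a.range ≤ 1 := a.range.finrank_le.trans (Module.finrank_self ℝ).le
  have hker : Module.finrank ℝ a.ker ≤ Module.finrank ℝ (G.rigidityMap L p).ker := by
    rw [← Submodule.finrank_map_subtype_eq]
    refine Submodule.finrank_mono ?_
    rintro _ ⟨w, hw, rfl⟩
    exact mem_ker_rigidityMap_of_deleteEdge w.2 hw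
  calc Module.finrank ℝ S = Module.finrank ℝ a.range + Module.finrank ℝ a.ker :=
      a.finrank_range_add_finrank_ker.symm
    _ ≤ Module.finrank ℝ (G.rigidityMap L p).ker + 1 := by omega

theorem finrank_ker_rigidityMap_deleteEdge_of_not_isPeriodicallyRigid [Finite V] [Finite E]
    (hp : IsGenericRealization L p) (hG : G.IsPeriodicallyGloballyRigid L p) {e : E}
    (he : ¬ (G.deleteEdge e).IsPeriodicallyRigid L p) :
    Module.finrank ℝ ((G.deleteEdge e).rigidityMap L p).ker =
      Module.finrank ℝ (infinitesimalCongruences (.span ℝ (range L)) p) + 1 := by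
  refine le_antisymm ?_ ?_
  · exact (finrank_ker_rigidityMap_deleteEdge_le e).trans
      (Nat.succ_le_succ (Submodule.finrank_mono (hG.ker_rigidityMap_le hp)))
  · exact Submodule.finrank_lt_finrank_of_lt (lt_of_le_not_ge
      ((G.deleteEdge e).infinitesimalCongruences_le_ker_rigidityMap p)
      (mt (isPeriodicallyRigid_of_ker_rigidityMap_le hp) he))

end GlobalRigidity

end LabeledGraph

theorem IsGenericRealization.injective {V Γ : Type*} [AddCommGroup Γ] {d : ℕ} [NeZero d]
    {L : Γ →+ EuclideanSpace ℝ (Fin d)} {p : V → EuclideanSpace ℝ (Fin d)}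
    (hp : IsGenericRealization L p) : Function.Injective p := fun u v huv =>
  congrArg Prod.fst <| AlgebraicIndependent.injective hp (a₁ := (u, 0)) (a₂ := (v, 0)) <| by
    simp only [huv]

namespace LabeledGraph

variable {V E Γ : Type*} [Finite E] [AddCommGroup Γ] {d : ℕ}
  {G : LabeledGraph V E Γ} {L : Γ →+ EuclideanSpace ℝ (Fin d)}
  {p q : V → EuclideanSpace ℝ (Fin d)} {e : E}

theorem finrank_ker_rigidityMap_deleteEdge_of_lengthSq_eq [Fintype V]
    (hV : Module.finrank ℝ (Submodule.span ℝ (range L))ᗮ + 2 ≤ Fintype.card V)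
    (hp : IsGenericRealization L p) (hG : G.IsPeriodicallyGloballyRigid L p)
    (he : ¬ (G.deleteEdge e).IsPeriodicallyRigid L p)
    (hq : (G.deleteEdge e).lengthSq L q = (G.deleteEdge e).lengthSq L p) :
    Module.finrank ℝ ((G.deleteEdge e).rigidityMap L q).ker =
        Module.finrank ℝ (infinitesimalCongruences (.span ℝ (range L)) p) + 1 ∧
      Module.finrank ℝ (infinitesimalCongruences (.span ℝ (range L)) q) =
        Module.finrank ℝ (infinitesimalCongruences (.span ℝ (range L)) p) := by
  have hker := ((G.deleteEdge e).finrank_ker_rigidityMap_eq_of_generic L hp hq).trans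
    (finrank_ker_rigidityMap_deleteEdge_of_not_isPeriodicallyRigid hp hG he)
  refine ⟨hker, (finrank_infinitesimalCongruences_eq_or_add_two_le
    (finrank_infinitesimalCongruences_le_of_generic hp) hV q).resolve_right fun hlt => ?_⟩
  have hle := Submodule.finrank_mono
    ((G.deleteEdge e).infinitesimalCongruences_le_ker_rigidityMap (L := L) q)
  omega

theorem IsConnected.exists_lengthSq_eq_of_finrank_ker_eq [Finite V] (hG : G.IsConnected)
    (hf : ∀ q, (G.deleteEdge e).lengthSq L q = (G.deleteEdge e).lengthSq L p →
      ∀ q' : V → EuclideanSpace ℝ (Fin d),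
      Module.finrank ℝ ((G.deleteEdge e).rigidityMap L q).ker ≤
        Module.finrank ℝ ((G.deleteEdge e).rigidityMap L q').ker)
    (hcongr : ∀ q, (G.deleteEdge e).lengthSq L q = (G.deleteEdge e).lengthSq L p →
      ∀ q' : V → EuclideanSpace ℝ (Fin d),
      Module.finrank ℝ (infinitesimalCongruences (.span ℝ (range L)) q) ≤
        Module.finrank ℝ (infinitesimalCongruences (.span ℝ (range L)) q'))
    (hdim : ∀ q, (G.deleteEdge e).lengthSq L q = (G.deleteEdge e).lengthSq L p →
      Module.finrank ℝ ((G.deleteEdge e).rigidityMap L q).ker =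
        Module.finrank ℝ (infinitesimalCongruences (.span ℝ (range L)) q) + 1)
    {w : V → EuclideanSpace ℝ (Fin d)} (hw : w ∈ ((G.deleteEdge e).rigidityMap L p).ker)
    (hwe : G.rigidityMap L p w e ≠ 0) :
    ∃ q, G.lengthSq L p = G.lengthSq L q ∧
      (complete V Γ).lengthSq L p ≠ (complete V Γ).lengthSq L q := by
  classical
  have := Fintype.ofFinite V
  have := Fintype.ofFinite E
  have : Nonempty V := ⟨G.src e⟩
  obtain ⟨s, h0, hs⟩ := exists_finset_span_image_eq L
  obtain ⟨K, hK, hKφ⟩ := hG.exists_isCompact L (G.lengthSq L p)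
  have hsub (q : V → EuclideanSpace ℝ (Fin d))
      (hq : (G.deleteEdge e).lengthSq L q = (G.deleteEdge e).lengthSq L p)
      (hqe : G.lengthSq L q e ≤ G.lengthSq L p e) :
      ∃ q' ∈ K, (completeOn V s).lengthSq L q' = (completeOn V s).lengthSq L q := by
    obtain ⟨φ, hφ, hφK⟩ := hKφ q (lengthSq_le_of_deleteEdge hq.le hqe)
    exact ⟨_, hφK, lengthSq_comp_of_isPeriodicIsometry _ hφ q⟩
  have hkerκ (q : V → EuclideanSpace ℝ (Fin d)) :
      (fderiv ℝ ((completeOn V s).lengthSq L) q).ker =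
        infinitesimalCongruences (.span ℝ (range L)) q := by
    rw [fderiv_lengthSq, ker_rigidityMap_completeOn h0 hs]
  obtain ⟨q, hq, hqe, hqκ⟩ := exists_eq_ne_of_fibreModulo_oneDimensional
    ((G.deleteEdge e).contDiff_lengthSq L) ((completeOn V s).contDiff_lengthSq L)
    (contDiff_pi.1 (G.contDiff_lengthSq L) e)
    (fun _ _ => lengthSq_eq_of_lengthSq_completeOn_eq _ h0 hs)
    (fun _ _ h => congrFun (lengthSq_eq_of_lengthSq_completeOn_eq G h0 hs h) e)
    (fun q => by
      rw [hkerκ, fderiv_lengthSq]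
      exact infinitesimalCongruences_le_ker_rigidityMap _ q)
    (isOpenMap_mk_ker_lengthSq_completeOn h0 hs)
    (fun q hq q' => by rw [fderiv_lengthSq, fderiv_lengthSq]; exact hf q hq q')
    (fun q hq q' => by rw [hkerκ, hkerκ]; exact hcongr q hq q')
    (fun q hq => by rw [hkerκ, fderiv_lengthSq]; exact hdim q hq)
    (by rwa [fderiv_lengthSq]) (by rwa [fderiv_lengthSq_apply]) hK hsub
  exact ⟨q, (lengthSq_eq_of_deleteEdge hq hqe).symm,
    fun h => hqκ (lengthSq_completeOn_eq_of_lengthSq_complete_eq h).symm⟩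

theorem exists_lengthSq_eq_of_not_isPeriodicallyRigid_deleteEdge [Fintype V] [NeZero d]
    (hV : Module.finrank ℝ (Submodule.span ℝ (range L))ᗮ + 2 ≤ Fintype.card V)
    (hp : IsGenericRealization L p) (hG : G.IsPeriodicallyGloballyRigid L p)
    (he : ¬ (G.deleteEdge e).IsPeriodicallyRigid L p) :
    ∃ q, G.lengthSq L p = G.lengthSq L q ∧
      (complete V Γ).lengthSq L p ≠ (complete V Γ).lengthSq L q := by
  have hdim {q : V → EuclideanSpace ℝ (Fin d)} :=
    finrank_ker_rigidityMap_deleteEdge_of_lengthSq_eq (q := q) hV hp hG he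
  obtain ⟨w, hw, hw'⟩ :=
    SetLike.not_le_iff_exists.1 (mt (isPeriodicallyRigid_of_ker_rigidityMap_le hp) he)
  refine IsConnected.exists_lengthSq_eq_of_finrank_ker_eq
    (hG.isConnected hp.injective) (fun q hq => ?_) (fun q hq => ?_) (fun q hq => ?_) hw
    fun hwe => hw' (hG.ker_rigidityMap_le hp (mem_ker_rigidityMap_of_deleteEdge hw hwe))
  · rw [finrank_ker_rigidityMap_eq_of_generic _ L hp hq]
    exact finrank_ker_rigidityMap_le_of_generic _ L hp
  · rw [(hdim hq).2]
    exact finrank_infinitesimalCongruences_le_of_generic hp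
  · rw [(hdim hq).1, (hdim hq).2]

end LabeledGraph

theorem lemma3p8_general {V E Γ : Type*} [Fintype V] [Finite E] [AddCommGroup Γ] {d : ℕ}
    (L : Γ →+ EuclideanSpace ℝ (Fin d)) (G : LabeledGraph V E Γ)
    (p : V → EuclideanSpace ℝ (Fin d)) (hp : IsGenericRealization L p)
    (hV : d + 2 ≤ Fintype.card V + Module.finrank ℝ (Submodule.span ℝ (range L)))
    (hG : G.IsPeriodicallyGloballyRigid L p) : G.IsRedundantlyPeriodicallyRigid L p := by
  intro e
  obtain rfl | hd := eq_zero_or_neZero d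
  · exact ⟨univ, isOpen_univ, mem_univ _, fun q _ _ => by rw [Subsingleton.elim p q]⟩
  have hU := (Submodule.span ℝ (range L)).finrank_add_finrank_orthogonal
  rw [finrank_euclideanSpace_fin] at hU
  by_contra he
  obtain ⟨q, hq, hpq⟩ :=
    G.exists_lengthSq_eq_of_not_isPeriodicallyRigid_deleteEdge (by omega) hp hG he
  exact hpq (hG q hq)

theorem lemma3p8 {V E Γ : Type*} [Fintype V] [Finite E] [AddCommGroup Γ] (d k : ℕ)
    (hΓ : Nonempty (Γ ≃+ (Fin k → ℤ)))
    (L : Γ →+ EuclideanSpace ℝ (Fin d)) (hL : IsNonsingularLattice k L)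
    (G : LabeledGraph V E Γ) (hloopless : G.IsLoopless) (hsemi : G.IsSemiSimple)
    (p : V → EuclideanSpace ℝ (Fin d)) (hp : IsGenericRealization L p)
    (hV : 1 ≤ k → d + 1 ≤ Fintype.card V) (hV' : k = 0 → d + 2 ≤ Fintype.card V)
    (hG : G.IsPeriodicallyGloballyRigid L p) :
    G.IsRedundantlyPeriodicallyRigid L p :=
  lemma3p8_general L G p hp (by rw [IsNonsingularLattice] at hL; omega) hG
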